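/- Work over $\mathbb{C}$, with coordinates $x,y,z$ on $\mathbb{P}^2$ and line at infinity $z=0$. Let $V^3$ be the space of differential forms $P\,dx+Q\,dy$ with $P,Q\in\mathbb{C}[x,y,z]$ homogeneous of degree $3$. Such a form is a Poincaré form if $P=Q=P_y=Q_x=0$ and $P_x=Q_y=1$ at $(0,0,1)$; let $V^3_{\mathrm{Poinc}}$ be the set of Poincaré forms. For a nonzero homogeneous $F$ of positive degree, the curve $C_F=\{F=0\}$ is an integral curve with cofactor $K_F$ (homogeneous of degree $2$) if $PF_y-QF_x=-FK_F$. The form is Darboux integrable if $Q_x-P_y$ is a $\mathbb{C}$-linear combination of cofactors of integral curves. Let $X_{(2,2)}\subset V^3_{\mathrm{Poinc}}$ be the set of Poincaré forms that have two smooth conics as integral curves, where the conics are not tangent to each other or to the line at infinity and do not meet each other on the line at infinity; $\overline{X_{(2,2)}}$ is its Zariski closure. For $c,k,l,m,n,p\in\mathbb{C}$ put $T=x+y+cz$, and let $\omega_{c,k,l,m,n,p}=P\,dx+Q\,dy$ be the normal form of Żołądek's family $CR_7$, with $$P=-\bigl(nxz^2+kyz^2+nTz^2+(m-l)x^2y+px^2T+mxyT+pxT^2\bigr),\quad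 Q=x\bigl(-(n+k)z^2+(l-m)xy-(l+p)xT\bigr).$$ Let $X_{CR7}\subset V^3_{\mathrm{Poinc}}$ be the set of all Poincaré forms that are pullbacks of some $\omega_{c,k,l,m,n,p}$ under an invertible affine change of the coordinates $x,y$ (with $z$ fixed). **Proposition.** (1) For all $(c,k,l,m,n,p)$ in some nonempty Zariski open subset of $\mathbb{C}^6$, the polynomials $$F=(lp-mp)x^2+(lm-m^2+lp-mp)xy+c(lp-mp)xz+(kp-mn)z^2,\qquad G=kz^2+lTx$$ are homogeneous of degree $2$ and linearly independent, and both conics $C_F$ and $C_G$ are integral curves of $\omega=\omega_{c,k,l,m,n,p}=P\,dx+Q\,dy$. Moreover $2l-m\neq0$, the numbers $a=\frac{l-m}{2l-m}$ and $b=\frac{l}{2l-m}$ are nonzero, the matrix $$M=\begin{pmatrix}F_x&G_x\\F_y&G_y\\aF&bG\end{pmatrix}$$ satisfies $(-Q,\,P,\,Q_x-P_y)\cdot M=0$ and has rank less than $2$ at only finitely many points of $\mathbb{P}^2$, and $\omega$ is Darboux integrable. (2) $X_{CR7}\subset\overline{X_{(2,2)}}$. -/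

import Mathlib

namespace CenterProblem

open MvPolynomial

/-- The coordinate ring `ℂ[x, y, z]` of the projective plane: `x = X 0`, `y = X 1`, `z = X 2`. -/
abbrev Poly : Type := MvPolynomial (Fin 3) ℂ

/-- The vector space of differential forms `P dx + Q dy` with `P`, `Q` homogeneous of degree `d`
in `x, y, z`; `ω.1` is `P` and `ω.2` is `Q`. -/
abbrev Form (d : ℕ) : Type :=
  homogeneousSubmodule (Fin 3) ℂ d × homogeneousSubmodule (Fin 3) ℂ d

namespace Form

variable {d : ℕ}

/-- The coefficient of `dx`. -/
noncomputable def P (ω : Form d) : Poly := (ω.1 : Poly)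

/-- The coefficient of `dy`. -/
noncomputable def Q (ω : Form d) : Poly := (ω.2 : Poly)

/-- `Q_x - P_y`, the coefficient of the exterior derivative in the affine plane `z = 1`. -/
noncomputable def curl (ω : Form d) : Poly := pderiv 0 ω.Q - pderiv 1 ω.P

/-- Poincaré differential forms: the point `(0 : 0 : 1)` is a critical point and the linear part
there is `x dx + y dy`. -/
def IsPoincare (ω : Form d) : Prop :=
  eval ![0, 0, 1] ω.P = 0 ∧ eval ![0, 0, 1] ω.Q = 0 ∧
  eval ![0, 0, 1] (pderiv 0 ω.P) = 1 ∧ eval ![0, 0, 1] (pderiv 1 ω.Q) = 1 ∧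
  eval ![0, 0, 1] (pderiv 1 ω.P) = 0 ∧ eval ![0, 0, 1] (pderiv 0 ω.Q) = 0

/-- The curve `F = 0`, where `F` is a nonzero homogeneous polynomial of positive degree, is an
integral curve of `ω` with cofactor `K`, that is, `P F_y - Q F_x = - F K`. -/
def IsIntegralCurveWithCofactor (ω : Form d) (F K : Poly) : Prop :=
  F ≠ 0 ∧ (∃ e : ℕ, 0 < e ∧ F.IsHomogeneous e) ∧ K.IsHomogeneous (d - 1) ∧
    ω.P * pderiv 1 F - ω.Q * pderiv 0 F = -(F * K)

/-- The curve `F = 0` is an integral curve of `ω`. -/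
def IsIntegralCurve (ω : Form d) (F : Poly) : Prop :=
  ∃ K : Poly, ω.IsIntegralCurveWithCofactor F K

/-- `ω` is Darboux integrable: `Q_x - P_y` is a linear combination of cofactors of algebraic
integral curves of `ω`. -/
def IsDarbouxIntegrable (ω : Form d) : Prop :=
  ∃ (n : ℕ) (F K : Fin n → Poly) (α : Fin n → ℂ),
    (∀ i, ω.IsIntegralCurveWithCofactor (F i) (K i)) ∧ ω.curl = ∑ i, C (α i) * K i

/-- The coefficients of `P` and of `Q`, as coordinates on the space of forms. (The coefficients of
monomials whose degree is not `d` are zero.) -/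
noncomputable def coords (ω : Form d) : (Fin 3 →₀ ℕ) ⊕ (Fin 3 →₀ ℕ) → ℂ :=
  Sum.elim (fun s => coeff s ω.P) (fun s => coeff s ω.Q)

end Form

/-- The Zariski closure of a set of forms: all forms at which every polynomial in the coefficients
that vanishes on `S` vanishes. -/
def zariskiClosure {d : ℕ} (S : Set (Form d)) : Set (Form d) :=
  {ω | ω.coords ∈ zeroLocus ℂ (vanishingIdeal ℂ (Form.coords '' S))}

/-- The gradient `(F_x, F_y, F_z)` of `F` at `v`. -/
noncomputable def gradient (F : Poly) (v : Fin 3 → ℂ) : Fin 3 → ℂ :=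
  fun i => eval v (pderiv i F)

/-- The plane projective curves `F i = 0` are smooth and in general position with respect to each
other and to the line at infinity `z = 0`. Points of the projective plane are represented by
nonzero vectors. -/
structure InGeneralPosition {n : ℕ} (F : Fin n → Poly) : Prop where
  smooth : ∀ i, ∀ v : Fin 3 → ℂ, v ≠ 0 → eval v (F i) = 0 → gradient (F i) v ≠ 0
  /-- No curve is tangent to the line at infinity. -/
  not_tangent_infinity : ∀ i, ∀ v : Fin 3 → ℂ, v ≠ 0 → v 2 = 0 → eval v (F i) = 0 →
    LinearIndependent ℂ ![gradient (F i) v, ![0, 0, 1]]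
  /-- No two curves are tangent to each other. -/
  not_tangent : ∀ i j, i ≠ j → ∀ v : Fin 3 → ℂ, v ≠ 0 → eval v (F i) = 0 → eval v (F j) = 0 →
    LinearIndependent ℂ ![gradient (F i) v, gradient (F j) v]
  /-- No two curves meet the line at infinity at the same point. -/
  not_meet_infinity : ∀ i j, i ≠ j → ∀ v : Fin 3 → ℂ, v ≠ 0 → v 2 = 0 →
    ¬ (eval v (F i) = 0 ∧ eval v (F j) = 0)
  /-- No three curves meet in the same point. -/
  not_three_meet : ∀ i j k, i ≠ j → i ≠ k → j ≠ k → ∀ v : Fin 3 → ℂ, v ≠ 0 →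
    ¬ (eval v (F i) = 0 ∧ eval v (F j) = 0 ∧ eval v (F k) = 0)

/-- The set `Y_e` of forms of degree `d` that have integral curves of degrees `e 0, e 1, …` in
general position (used with `d + 1 = ∑ i, e i`). -/
def Y (d : ℕ) {n : ℕ} (e : Fin n → ℕ) : Set (Form d) :=
  {ω | ∃ F : Fin n → Poly, (∀ i, (F i).IsHomogeneous (e i)) ∧ InGeneralPosition F ∧
    ∀ i, ω.IsIntegralCurve (F i)}

/-- The set `X_e` of Poincaré differential forms in `Y_e`. -/
def X (d : ℕ) {n : ℕ} (e : Fin n → ℕ) : Set (Form d) :=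
  {ω | ω ∈ Y d e ∧ ω.IsPoincare}

/-- Substitution in a homogeneous polynomial of the affine map
`(x, y) ↦ (A₀₀ x + A₀₁ y + t₀ z, A₁₀ x + A₁₁ y + t₁ z)`, `z ↦ z`. -/
noncomputable def affineSubst (A : Matrix (Fin 2) (Fin 2) ℂ) (t : Fin 2 → ℂ) : Poly →ₐ[ℂ] Poly :=
  aeval ![C (A 0 0) * MvPolynomial.X 0 + C (A 0 1) * MvPolynomial.X 1 + C (t 0) * MvPolynomial.X 2,
    C (A 1 0) * MvPolynomial.X 0 + C (A 1 1) * MvPolynomial.X 1 + C (t 1) * MvPolynomial.X 2,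
    MvPolynomial.X 2]

theorem isHomogeneous_linear (a b c : ℂ) :
    (C a * MvPolynomial.X 0 + C b * MvPolynomial.X 1 + C c * MvPolynomial.X 2 :
      Poly).IsHomogeneous 1 :=
  ((isHomogeneous_C_mul_X _ _).add (isHomogeneous_C_mul_X _ _)).add (isHomogeneous_C_mul_X _ _)

theorem affineSubst_isHomogeneous (A : Matrix (Fin 2) (Fin 2) ℂ) (t : Fin 2 → ℂ) {F : Poly}
    {d : ℕ} (hF : F.IsHomogeneous d) : (affineSubst A t F).IsHomogeneous d := by
  have h := hF.aeval (n := 1) ![C (A 0 0) * MvPolynomial.X 0 + C (A 0 1) * MvPolynomial.X 1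
      + C (t 0) * MvPolynomial.X 2,
    C (A 1 0) * MvPolynomial.X 0 + C (A 1 1) * MvPolynomial.X 1 + C (t 1) * MvPolynomial.X 2,
    (MvPolynomial.X 2 : Poly)] (by
      intro i
      fin_cases i
      · exact isHomogeneous_linear _ _ _
      · exact isHomogeneous_linear _ _ _
      · exact isHomogeneous_X _ _)
  rw [one_mul] at h
  exact h

/-- The pullback of `P dx + Q dy` under the affine map `φ` given by `A` and `t`:
`(A₀₀ P∘φ + A₁₀ Q∘φ) dx + (A₀₁ P∘φ + A₁₁ Q∘φ) dy`. -/
noncomputable def Form.pullback {d : ℕ} (A : Matrix (Fin 2) (Fin 2) ℂ) (t : Fin 2 → ℂ)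
    (ω : Form d) : Form d :=
  (⟨C (A 0 0) * affineSubst A t ω.P + C (A 1 0) * affineSubst A t ω.Q,
      ((affineSubst_isHomogeneous A t ω.1.2).C_mul _).add
        ((affineSubst_isHomogeneous A t ω.2.2).C_mul _)⟩,
   ⟨C (A 0 1) * affineSubst A t ω.P + C (A 1 1) * affineSubst A t ω.Q,
      ((affineSubst_isHomogeneous A t ω.1.2).C_mul _).add
        ((affineSubst_isHomogeneous A t ω.2.2).C_mul _)⟩)

namespace CR7

/-- The coordinate `x`. -/
noncomputable abbrev x : Poly := MvPolynomial.X 0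

/-- The coordinate `y`. -/
noncomputable abbrev y : Poly := MvPolynomial.X 1

/-- The coordinate `z`; the line at infinity is `z = 0`. -/
noncomputable abbrev z : Poly := MvPolynomial.X 2

/-- `T = x + y + c`, homogenized. -/
noncomputable def T (c : ℂ) : Poly := x + y + C c * z

/-- The coefficient of `dx` in the normal form of the family, homogenized. -/
noncomputable def polyP (c k l m n p : ℂ) : Poly :=
  -(C n * x * z ^ 2 + C k * y * z ^ 2 + C n * T c * z ^ 2 + C (m - l) * x ^ 2 * y
    + C p * x ^ 2 * T c + C m * x * y * T c + C p * x * T c ^ 2)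

/-- The coefficient of `dy` in the normal form of the family, homogenized. -/
noncomputable def polyQ (c k l m n p : ℂ) : Poly :=
  x * (-(C (n + k) * z ^ 2) + C (l - m) * x * y - C (l + p) * x * T c)

/-- The conic
`(lp - mp) x² + (lm - m² + lp - mp) x y + c (lp - mp) x + (kp - mn)`, homogenized. -/
noncomputable def conicF (c k l m n p : ℂ) : Poly :=
  C (l * p - m * p) * x ^ 2 + C (l * m - m ^ 2 + l * p - m * p) * x * y
    + C (c * (l * p - m * p)) * x * z + C (-(m * n) + k * p) * z ^ 2

/-- The conic `k + l T x`, homogenized. -/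
noncomputable def conicG (c k l : ℂ) : Poly :=
  C k * z ^ 2 + C l * T c * x

theorem isHomogeneous_T (c : ℂ) : (T c).IsHomogeneous 1 :=
  ((isHomogeneous_X _ _).add (isHomogeneous_X _ _)).add (isHomogeneous_C_mul_X _ _)

theorem isHomogeneous_polyP (c k l m n p : ℂ) : (polyP c k l m n p).IsHomogeneous 3 := by
  have hx : (x).IsHomogeneous 1 := isHomogeneous_X _ _
  have hy : (y).IsHomogeneous 1 := isHomogeneous_X _ _
  have hz : (z).IsHomogeneous 1 := isHomogeneous_X _ _
  have hT := isHomogeneous_T c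
  exact (((((((hx.C_mul n).mul (hz.pow 2)).add ((hy.C_mul k).mul (hz.pow 2))).add
    ((hT.C_mul n).mul (hz.pow 2))).add (((hx.pow 2).C_mul (m - l)).mul hy)).add
    (((hx.pow 2).C_mul p).mul hT)).add (((hx.C_mul m).mul hy).mul hT)).add
    ((hx.C_mul p).mul (hT.pow 2)) |>.neg

theorem isHomogeneous_polyQ (c k l m n p : ℂ) : (polyQ c k l m n p).IsHomogeneous 3 := by
  have hx : (x).IsHomogeneous 1 := isHomogeneous_X _ _
  have hy : (y).IsHomogeneous 1 := isHomogeneous_X _ _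
  have hz : (z).IsHomogeneous 1 := isHomogeneous_X _ _
  have hT := isHomogeneous_T c
  exact hx.mul (((((hz.pow 2).C_mul (n + k)).neg).add ((hx.C_mul (l - m)).mul hy)).sub
    ((hx.C_mul (l + p)).mul hT))

/-- The normal form of the family with parameters `c, k, l, m, n, p`. -/
noncomputable def form (c k l m n p : ℂ) : Form 3 :=
  (⟨polyP c k l m n p, isHomogeneous_polyP c k l m n p⟩,
   ⟨polyQ c k l m n p, isHomogeneous_polyQ c k l m n p⟩)

/-- The family in all affine coordinate systems: pullbacks of the normal forms under invertible
affine maps. (Scalar multiples are obtained by scaling `k, l, m, n, p`.) -/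
def family : Set (Form 3) :=
  {ω | ∃ (A : Matrix (Fin 2) (Fin 2) ℂ) (t : Fin 2 → ℂ) (c k l m n p : ℂ),
    IsUnit A.det ∧ ω = (form c k l m n p).pullback A t}

/-- The Poincaré differential forms in the family. -/
def poincareFamily : Set (Form 3) := {ω | ω ∈ family ∧ ω.IsPoincare}

end CR7

/-- The `3 × 2` matrix with rows `(F_x, G_x)`, `(F_y, G_y)`, `(a F, b G)`. -/
noncomputable def syzygyMatrix (F G : Poly) (a b : ℂ) : Matrix (Fin 3) (Fin 2) Poly :=
  !![pderiv 0 F, pderiv 0 G; pderiv 1 F, pderiv 1 G; C a * F, C b * G]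

/-- The points of the projective plane where a `3 × 2` matrix of polynomials has rank less
than `2` (used for matrices whose rows are homogeneous, where the rank does not depend on the
representative of the point). -/
def rankDropLocus (M : Matrix (Fin 3) (Fin 2) Poly) : Set (Projectivization ℂ (Fin 3 → ℂ)) :=
  {q | (M.map (eval q.rep)).rank < 2}

end CenterProblem

/-!
A form of the family is the pullback of a linear one. With `R = x (x + c z)` and `S = x T`,
`ω = (k z² + l S) dR + (-(n + k) z² - (l - m) R - (m + p) S) dS`, so in the affine plane `ω` comes
from a linear vector field in the `(R, S)`-plane, whose two invariant lines give the conics `F` and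
`G`. All identities of the first part follow; the Jacobian of `F` and `G` is a multiple of
`x (2 x + c z)`, and on these two lines `P` and `Q` leave three points for the rank drop locus
(`CR7.finite_rankDropLocus`).

For the second part, an affine change of coordinates replaces `R`, `S` by other quadratic
polynomials `U`, `V`, and every Poincaré form `(p₀ + p₁ U + p₂ V) dU + (q₀ + q₁ U + q₂ V) dV` lies
in the closure (`linForm_mem_zariskiClosure`), for all values of the parameters. Let `U` and `V`
vanish at the critical point.

* If `(p₀, q₀) ≠ 0`, a linear substitution makes it `(1, 0)`. The Poincaré condition then says that
  `U = (x² + y² - q₂ V₁²) / 2`, with `V₁` the linear part of `V`, and leaves `p₁, p₂, q₁, q₂, V`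
  free. On a line in this parameter space all but finitely many vector fields have two distinct
  nonzero eigenvalues, which makes the form `β G dF - α F dG` for conics that avoid the critical
  point (`linForm_foldQuad_mem`). Such pairs, for fixed `α` and `β`, again form an irreducible
  family, and it contains pairs of diagonal conics in general position
  (`diffForm_mem_of_eval_ne_zero`).
* If `p₀ = q₀ = 0`, the form is `d (F G) / 2` for two conics that cross at the critical point in the
  directions `x ± i y = 0`; these pairs form an affine space (`diffForm_mem_of_crossing`).

In both cases one good member of the family suffices: general position is an open condition by
compactness of the sphere (`eventually_inGeneralPosition`), and a polynomial that vanishes on an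
infinite part of a polynomial curve vanishes on the whole curve (`mem_zariskiClosure_of_infinite`).
Two closure steps compose, because the closure of a closed set is itself.
-/

namespace CenterProblem

open MvPolynomial Filter Topology
open scoped Polynomial

/-! ### Polynomial curves and the Zariski closure -/

/-- A family of polynomials in `x, y, z` that depends polynomially on one complex parameter. -/
def IsPolyCurve (f : ℂ → Poly) : Prop :=
  ∃ p : Poly[X], ∀ s, f s = p.eval (C s)

namespace IsPolyCurve

variable {f g : ℂ → Poly}

theorem const (F : Poly) : IsPolyCurve fun _ => F := ⟨Polynomial.C F, fun s => by simp⟩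

theorem C_eval (p : ℂ[X]) : IsPolyCurve fun s => C (p.eval s) :=
  ⟨p.map C, fun s => by
    simp only [Polynomial.eval_map, Polynomial.eval₂_at_apply]⟩

theorem add (hf : IsPolyCurve f) (hg : IsPolyCurve g) : IsPolyCurve fun s => f s + g s := by
  obtain ⟨p, hp⟩ := hf
  obtain ⟨q, hq⟩ := hg
  exact ⟨p + q, fun s => by simp [hp, hq]⟩

theorem mul (hf : IsPolyCurve f) (hg : IsPolyCurve g) : IsPolyCurve fun s => f s * g s := by
  obtain ⟨p, hp⟩ := hf
  obtain ⟨q, hq⟩ := hg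
  exact ⟨p * q, fun s => by simp [hp, hq]⟩

theorem pderiv (i : Fin 3) (hf : IsPolyCurve f) :
    IsPolyCurve fun s => MvPolynomial.pderiv i (f s) := by
  obtain ⟨p, hp⟩ := hf
  suffices h : IsPolyCurve fun s => MvPolynomial.pderiv i (p.eval (C s)) by
    simpa only [← hp] using h
  clear hp
  induction p using Polynomial.induction_on' with
  | add p q hp hq => simpa using hp.add hq
  | monomial n a =>
    exact ⟨Polynomial.monomial n (MvPolynomial.pderiv i a), fun s => by
      simp only [Polynomial.eval_monomial, ← C_pow, pderiv_mul, pderiv_C, mul_zero, add_zero]⟩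

theorem exists_coeff_eq (hf : IsPolyCurve f) (m : Fin 3 →₀ ℕ) :
    ∃ q : ℂ[X], ∀ s, coeff m (f s) = q.eval s := by
  obtain ⟨p, hp⟩ := hf
  suffices h : ∃ q : ℂ[X], ∀ s, coeff m (p.eval (C s)) = q.eval s by simpa only [hp] using h
  clear hp
  induction p using Polynomial.induction_on' with
  | add p q hp hq =>
    obtain ⟨p', hp⟩ := hp
    obtain ⟨q', hq⟩ := hq
    exact ⟨p' + q', fun s => by simp [hp, hq]⟩
  | monomial n a =>
    exact ⟨Polynomial.monomial n (coeff m a), fun s => by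
      rw [Polynomial.eval_monomial, Polynomial.eval_monomial, ← C_pow, mul_comm a,
        coeff_C_mul, mul_comm]⟩

theorem continuous_eval (hf : IsPolyCurve f) :
    Continuous fun w : ℂ × (Fin 3 → ℂ) => eval w.2 (f w.1) := by
  obtain ⟨p, hp⟩ := hf
  simp only [hp]
  clear hp
  induction p using Polynomial.induction_on' with
  | add p q hp hq => simpa using Continuous.fun_add hp hq
  | monomial n a =>
    simp only [Polynomial.eval_monomial, map_mul, map_pow, eval_C]
    exact ((MvPolynomial.continuous_eval a).comp continuous_snd).mul (continuous_fst.pow n)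

end IsPolyCurve

variable {d : ℕ}

theorem zariskiClosure_subset_of_subset {S T : Set (Form d)} (h : S ⊆ zariskiClosure T) :
    zariskiClosure S ⊆ zariskiClosure T := by
  intro ω hω
  refine mem_zeroLocus_iff.2 fun p hp => mem_zeroLocus_iff.1 hω p ?_
  rw [mem_vanishingIdeal_iff]
  rintro _ ⟨η, hη, rfl⟩
  exact mem_zeroLocus_iff.1 (h hη) p hp

/-- A polynomial curve that meets `S` infinitely often lies in the Zariski closure of `S`: the
restriction to the curve of an equation of `S` is a polynomial in one variable with infinitely
many zeros. -/
theorem mem_zariskiClosure_of_infinite {S : Set (Form d)} (γ : ℂ → Form d)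
    (hP : IsPolyCurve fun s => (γ s).P) (hQ : IsPolyCurve fun s => (γ s).Q)
    (hS : {s | γ s ∈ S}.Infinite) (s : ℂ) : γ s ∈ zariskiClosure S := by
  have hcoord : ∀ j, ∃ q : ℂ[X], ∀ s, (γ s).coords j = q.eval s := by
    rintro (m | m)
    · exact hP.exists_coeff_eq m
    · exact hQ.exists_coeff_eq m
  choose q hq using hcoord
  refine mem_zeroLocus_iff.2 fun p hp => ?_
  have heval : ∀ s, aeval (γ s).coords p = (aeval q p).eval s := by
    intro s
    rw [show (γ s).coords = fun j => (q j).eval s from funext fun j => hq j s,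
      ← Polynomial.coe_aeval_eq_eval s]
    exact (comp_aeval_apply (R := ℂ) q (Polynomial.aeval s) p).symm
  have hzero : aeval q p = 0 := by
    refine Polynomial.eq_zero_of_infinite_isRoot _ (hS.mono fun s hs => ?_)
    rw [Set.mem_ofPred_eq, Polynomial.IsRoot, ← heval]
    exact mem_vanishingIdeal_iff.1 hp _ ⟨_, hs, rfl⟩
  rw [heval, hzero, Polynomial.eval_zero]

/-! ### General position is an open condition -/

theorem eval_smul_of_isHomogeneous {F : Poly} {e : ℕ} (hF : F.IsHomogeneous e) (r : ℂ)
    (v : Fin 3 → ℂ) : eval (r • v) F = r ^ e * eval v F := by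
  rw [eval_eq, eval_eq, Finset.mul_sum]
  refine Finset.sum_congr rfl fun m hm => ?_
  have hdeg : ∑ i ∈ m.support, m i = e := by
    rw [← hF (mem_support_iff.1 hm), Finsupp.weight_apply, Finsupp.sum]
    simp
  simp only [Pi.smul_apply, smul_eq_mul, mul_pow, Finset.prod_mul_distrib]
  rw [Finset.prod_pow_eq_pow_sum, hdeg]
  ring

theorem gradient_smul_of_isHomogeneous {F : Poly} {e : ℕ} (hF : F.IsHomogeneous e) (r : ℂ)
    (v : Fin 3 → ℂ) : gradient F (r • v) = r ^ (e - 1) • gradient F v := by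
  ext i
  exact eval_smul_of_isHomogeneous hF.pderiv r v

/-- A continuous family of functions without a zero on the unit sphere keeps this property under
small changes of the parameter, by compactness of the sphere. -/
theorem eventually_forall_sphere_ne_zero {W : Type*} [TopologicalSpace W] [T1Space W] [Zero W]
    {f : ℂ × (Fin 3 → ℂ) → W} (hf : Continuous f) {s₀ : ℂ}
    (h : ∀ v : Fin 3 → ℂ, v ≠ 0 → f (s₀, v) ≠ 0) :
    ∀ᶠ s in 𝓝 s₀, ∀ v : Fin 3 → ℂ, ‖v‖ = 1 → f (s, v) ≠ 0 := by
  have key := (isCompact_sphere (0 : Fin 3 → ℂ) 1).eventually_forall_of_forall_eventually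
    (x₀ := s₀) (P := fun s v => f (s, v) ≠ 0) (fun v hv => by
      refine hf.continuousAt.eventually_ne (h v ?_)
      rintro rfl
      simp at hv)
  filter_upwards [key] with s hs v hv
  exact hs v (by simpa using hv)

theorem exists_eq_smul_norm_eq_one {v : Fin 3 → ℂ} (hv : v ≠ 0) :
    ∃ (r : ℂ) (w : Fin 3 → ℂ), r ≠ 0 ∧ ‖w‖ = 1 ∧ v = r • w := by
  have hn : (‖v‖ : ℂ) ≠ 0 := by simpa using hv
  refine ⟨‖v‖, (‖v‖ : ℂ)⁻¹ • v, hn, ?_, (smul_inv_smul₀ hn v).symm⟩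
  rw [norm_smul, norm_inv, Complex.norm_real, norm_norm, inv_mul_cancel₀ (by simpa using hv)]

theorem continuous_gradient {f : ℂ → Poly} (hf : IsPolyCurve f) :
    Continuous fun w : ℂ × (Fin 3 → ℂ) => gradient (f w.1) w.2 :=
  continuous_pi fun i => (hf.pderiv i).continuous_eval

theorem continuous_crossProduct {α : Type*} [TopologicalSpace α] {f g : α → Fin 3 → ℂ}
    (hf : Continuous f) (hg : Continuous g) : Continuous fun a => crossProduct (f a) (g a) := by
  have hf' := fun i => (continuous_apply i).comp hf
  have hg' := fun i => (continuous_apply i).comp hg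
  simp only [cross_apply]
  refine continuous_pi fun i => ?_
  fin_cases i
  · exact ((hf' 1).mul (hg' 2)).sub ((hf' 2).mul (hg' 1))
  · exact ((hf' 2).mul (hg' 0)).sub ((hf' 0).mul (hg' 2))
  · exact ((hf' 0).mul (hg' 1)).sub ((hf' 1).mul (hg' 0))

/-- Each condition of general position says that a continuous function of the parameter and of
the point, homogeneous in the point, has no zero. -/
theorem eventually_inGeneralPosition {n : ℕ} {F : ℂ → Fin n → Poly} {e : Fin n → ℕ}
    (hF : ∀ i, IsPolyCurve fun s => F s i) (hom : ∀ s i, (F s i).IsHomogeneous (e i)) {s₀ : ℂ}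
    (h : InGeneralPosition (F s₀)) : ∀ᶠ s in 𝓝 s₀, InGeneralPosition (F s) := by
  have hev := fun i => (hF i).continuous_eval
  have hgr := fun i => continuous_gradient (hF i)
  have hv2 : Continuous fun w : ℂ × (Fin 3 → ℂ) => w.2 2 :=
    (continuous_apply 2).comp continuous_snd
  have h₁ := eventually_all.2 fun i => eventually_forall_sphere_ne_zero
    ((hev i).prodMk (hgr i)) (s₀ := s₀) (fun v hv h0 => by
      simp only [Prod.mk_eq_zero] at h0
      exact h.smooth i v hv h0.1 h0.2)
  have h₂ := eventually_all.2 fun i => eventually_forall_sphere_ne_zero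
    (hv2.prodMk ((hev i).prodMk
      (continuous_crossProduct (hgr i) (continuous_const (y := ![0, 0, 1])))))
    (s₀ := s₀) (fun v hv h0 => by
      simp only [Prod.mk_eq_zero] at h0
      exact crossProduct_ne_zero_iff_linearIndependent.2
        (h.not_tangent_infinity i v hv h0.1 h0.2.1) h0.2.2)
  have h₃ := eventually_all.2 fun i => eventually_all.2 fun j => eventually_all.2
    fun hij : i ≠ j => eventually_forall_sphere_ne_zero
    ((hev i).prodMk ((hev j).prodMk (continuous_crossProduct (hgr i) (hgr j))))
    (s₀ := s₀) (fun v hv h0 => by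
      simp only [Prod.mk_eq_zero] at h0
      exact crossProduct_ne_zero_iff_linearIndependent.2
        (h.not_tangent i j hij v hv h0.1 h0.2.1) h0.2.2)
  have h₄ := eventually_all.2 fun i => eventually_all.2 fun j => eventually_all.2
    fun hij : i ≠ j => eventually_forall_sphere_ne_zero
    (hv2.prodMk ((hev i).prodMk (hev j)))
    (s₀ := s₀) (fun v hv h0 => by
      simp only [Prod.mk_eq_zero] at h0
      exact h.not_meet_infinity i j hij v hv h0.1 h0.2)
  have h₅ := eventually_all.2 fun i => eventually_all.2 fun j => eventually_all.2 fun k =>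
    eventually_all.2 fun hij : i ≠ j => eventually_all.2 fun hik : i ≠ k => eventually_all.2
    fun hjk : j ≠ k => eventually_forall_sphere_ne_zero
    ((hev i).prodMk ((hev j).prodMk (hev k)))
    (s₀ := s₀) (fun v hv h0 => by
      simp only [Prod.mk_eq_zero] at h0
      exact h.not_three_meet i j k hij hik hjk v hv h0)
  filter_upwards [h₁, h₂, h₃, h₄, h₅] with s g₁ g₂ g₃ g₄ g₅
  have hzero : ∀ {r : ℂ} {w : Fin 3 → ℂ} {i}, r ≠ 0 → eval (r • w) (F s i) = 0 →
      eval w (F s i) = 0 := fun {r w i} hr h0 => by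
    rw [eval_smul_of_isHomogeneous (hom s i)] at h0
    exact (mul_eq_zero.1 h0).resolve_left (pow_ne_zero _ hr)
  have hgrad := fun r w i => gradient_smul_of_isHomogeneous (hom s i) r w
  have htwo : ∀ {r : ℂ} {w : Fin 3 → ℂ}, r ≠ 0 → (r • w) 2 = 0 → w 2 = 0 := fun hr h0 =>
    (mul_eq_zero.1 h0).resolve_left hr
  constructor
  · intro i v hv hFv hg
    obtain ⟨r, w, hr, hw, rfl⟩ := exists_eq_smul_norm_eq_one hv
    rw [hgrad, smul_eq_zero] at hg
    exact g₁ i w hw (Prod.ext (hzero hr hFv) (hg.resolve_left (pow_ne_zero _ hr)))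
  · intro i v hv hv2 hFv
    obtain ⟨r, w, hr, hw, rfl⟩ := exists_eq_smul_norm_eq_one hv
    refine crossProduct_ne_zero_iff_linearIndependent.1 fun hc => ?_
    rw [hgrad, LinearMap.map_smul₂, smul_eq_zero] at hc
    exact g₂ i w hw (Prod.ext (htwo hr hv2)
      (Prod.ext (hzero hr hFv) (hc.resolve_left (pow_ne_zero _ hr))))
  · intro i j hij v hv hFi hFj
    obtain ⟨r, w, hr, hw, rfl⟩ := exists_eq_smul_norm_eq_one hv
    refine crossProduct_ne_zero_iff_linearIndependent.1 fun hc => ?_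
    rw [hgrad, hgrad, LinearMap.map_smul₂, map_smul, smul_eq_zero, smul_eq_zero] at hc
    exact g₃ i j hij w hw (Prod.ext (hzero hr hFi) (Prod.ext (hzero hr hFj)
      ((hc.resolve_left (pow_ne_zero _ hr)).resolve_left (pow_ne_zero _ hr))))
  · rintro i j hij v hv hv2 ⟨hFi, hFj⟩
    obtain ⟨r, w, hr, hw, rfl⟩ := exists_eq_smul_norm_eq_one hv
    exact g₄ i j hij w hw (Prod.ext (htwo hr hv2) (Prod.ext (hzero hr hFi) (hzero hr hFj)))
  · rintro i j k hij hik hjk v hv ⟨hFi, hFj, hFk⟩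
    obtain ⟨r, w, hr, hw, rfl⟩ := exists_eq_smul_norm_eq_one hv
    exact g₅ i j k hij hik hjk w hw
      (Prod.ext (hzero hr hFi) (Prod.ext (hzero hr hFj) (hzero hr hFk)))

/-! ### Forms spanned by pairs of conics -/

/-- The space of homogeneous quadratic polynomials in `x, y, z`. -/
abbrev Quad : Type := homogeneousSubmodule (Fin 3) ℂ 2

/-- The form `L dU + M dV`, with the differentials taken in the affine coordinates `x, y`. -/
noncomputable def diffForm (L M U V : Quad) : Form 3 :=
  (⟨L * pderiv 0 (U : Poly) + M * pderiv 0 (V : Poly),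
    (L.2.mul (IsHomogeneous.pderiv U.2)).add (M.2.mul (IsHomogeneous.pderiv V.2))⟩,
   ⟨L * pderiv 1 (U : Poly) + M * pderiv 1 (V : Poly),
    (L.2.mul (IsHomogeneous.pderiv U.2)).add (M.2.mul (IsHomogeneous.pderiv V.2))⟩)

theorem diffForm_P (L M U V : Quad) :
    (diffForm L M U V).P = L * pderiv 0 (U : Poly) + M * pderiv 0 (V : Poly) := rfl

theorem diffForm_Q (L M U V : Quad) :
    (diffForm L M U V).Q = L * pderiv 1 (U : Poly) + M * pderiv 1 (V : Poly) := rfl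

theorem Form.ext_PQ {d : ℕ} {ω η : Form d} (hP : ω.P = η.P) (hQ : ω.Q = η.Q) : ω = η :=
  Prod.ext (Subtype.ext hP) (Subtype.ext hQ)

theorem diffForm_swap (L M U V : Quad) : diffForm L M U V = diffForm M L V U :=
  Form.ext_PQ (add_comm _ _) (add_comm _ _)

/-- The quadratic polynomial `h z² + a x z + b y z + c x² + d x y + e y²`. -/
noncomputable def conic (h a b c d e : ℂ) : Quad :=
  ⟨C h * MvPolynomial.X 2 ^ 2 + C a * (MvPolynomial.X 0 * MvPolynomial.X 2)
    + C b * (MvPolynomial.X 1 * MvPolynomial.X 2) + C c * MvPolynomial.X 0 ^ 2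
    + C d * (MvPolynomial.X 0 * MvPolynomial.X 1) + C e * MvPolynomial.X 1 ^ 2,
    by
      have hX : ∀ i, (MvPolynomial.X i : Poly).IsHomogeneous 1 := fun i => isHomogeneous_X _ _
      exact ((((((hX 2).pow 2).C_mul h).add (((hX 0).mul (hX 2)).C_mul a)).add
        (((hX 1).mul (hX 2)).C_mul b)).add (((hX 0).pow 2).C_mul c)).add
        (((hX 0).mul (hX 1)).C_mul d) |>.add (((hX 1).pow 2).C_mul e)⟩

theorem conic_add (h a b c d e h' a' b' c' d' e' : ℂ) :
    conic h a b c d e + conic h' a' b' c' d' e'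
      = conic (h + h') (a + a') (b + b') (c + c') (d + d') (e + e') := by
  ext1
  simp only [conic, Submodule.coe_add, C_add]
  ring

theorem smul_conic (r h a b c d e : ℂ) :
    r • conic h a b c d e = conic (r * h) (r * a) (r * b) (r * c) (r * d) (r * e) := by
  ext1
  simp only [conic, Submodule.coe_smul, C_mul, smul_eq_C_mul]
  ring

theorem pderiv_zero_conic (h a b c d e : ℂ) :
    pderiv 0 (conic h a b c d e : Poly)
      = C (2 * c) * MvPolynomial.X 0 + C d * MvPolynomial.X 1 + C a * MvPolynomial.X 2 := by
  simp only [conic, map_add, pderiv_mul, pderiv_pow, pderiv_X, pderiv_C, Pi.single_apply,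
    Fin.isValue, C_mul, map_ofNat]
  simp
  ring

theorem pderiv_one_conic (h a b c d e : ℂ) :
    pderiv 1 (conic h a b c d e : Poly)
      = C d * MvPolynomial.X 0 + C (2 * e) * MvPolynomial.X 1 + C b * MvPolynomial.X 2 := by
  simp only [conic, map_add, pderiv_mul, pderiv_pow, pderiv_X, pderiv_C, Pi.single_apply,
    Fin.isValue, C_mul, map_ofNat]
  simp
  ring

theorem eval_conic (h a b c d e : ℂ) (v : Fin 3 → ℂ) :
    eval v (conic h a b c d e : Poly) = h * v 2 ^ 2 + a * (v 0 * v 2) + b * (v 1 * v 2)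
      + c * v 0 ^ 2 + d * (v 0 * v 1) + e * v 1 ^ 2 := by
  simp [conic]

theorem gradient_conic (h a b c d e : ℂ) (v : Fin 3 → ℂ) :
    gradient (conic h a b c d e : Poly) v = ![2 * c * v 0 + d * v 1 + a * v 2,
      d * v 0 + 2 * e * v 1 + b * v 2, a * v 0 + b * v 1 + 2 * h * v 2] := by
  ext i
  fin_cases i
  · simp [gradient, pderiv_zero_conic]
  · simp [gradient, pderiv_one_conic]
  · simp only [gradient, conic, map_add, pderiv_mul, pderiv_pow, pderiv_X, pderiv_C,
      Pi.single_apply, Fin.isValue]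
    simp
    ring

theorem isPoincare_diffForm_iff (l₀ l₁ l₂ l₃ l₄ l₅ m₀ m₁ m₂ m₃ m₄ m₅ u₀ u₁ u₂ u₃ u₄ u₅
    v₀ v₁ v₂ v₃ v₄ v₅ : ℂ) :
    (diffForm (conic l₀ l₁ l₂ l₃ l₄ l₅) (conic m₀ m₁ m₂ m₃ m₄ m₅) (conic u₀ u₁ u₂ u₃ u₄ u₅)
      (conic v₀ v₁ v₂ v₃ v₄ v₅)).IsPoincare ↔
      l₀ * u₁ + m₀ * v₁ = 0 ∧ l₀ * u₂ + m₀ * v₂ = 0 ∧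
      l₁ * u₁ + l₀ * (2 * u₃) + (m₁ * v₁ + m₀ * (2 * v₃)) = 1 ∧
      l₂ * u₂ + l₀ * (2 * u₅) + (m₂ * v₂ + m₀ * (2 * v₅)) = 1 ∧
      l₂ * u₁ + l₀ * u₄ + (m₂ * v₁ + m₀ * v₄) = 0 ∧
      l₁ * u₂ + l₀ * u₄ + (m₁ * v₂ + m₀ * v₄) = 0 := by
  have h₀ : ∀ h a b c d e : ℂ, eval ![0, 0, 1] (pderiv 0 (conic h a b c d e : Poly)) = a := by
    intros; simp [pderiv_zero_conic]
  have h₁ : ∀ h a b c d e : ℂ, eval ![0, 0, 1] (pderiv 1 (conic h a b c d e : Poly)) = b := by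
    intros; simp [pderiv_one_conic]
  have h₂ : ∀ h a b c d e : ℂ, eval ![0, 0, 1] (conic h a b c d e : Poly) = h := by
    intros; simp [eval_conic]
  have h₃ : ∀ h a b c d e : ℂ,
      eval ![0, 0, 1] (pderiv 0 (pderiv 0 (conic h a b c d e : Poly))) = 2 * c := by
    intros; simp [pderiv_zero_conic, pderiv_X]
  have h₄ : ∀ h a b c d e : ℂ,
      eval ![0, 0, 1] (pderiv 0 (pderiv 1 (conic h a b c d e : Poly))) = d := by
    intros; simp [pderiv_one_conic, pderiv_X]
  have h₅ : ∀ h a b c d e : ℂ,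
      eval ![0, 0, 1] (pderiv 1 (pderiv 0 (conic h a b c d e : Poly))) = d := by
    intros; simp [pderiv_zero_conic, pderiv_X]
  have h₆ : ∀ h a b c d e : ℂ,
      eval ![0, 0, 1] (pderiv 1 (pderiv 1 (conic h a b c d e : Poly))) = 2 * e := by
    intros; simp [pderiv_one_conic, pderiv_X]
  simp only [Form.IsPoincare, diffForm_P, diffForm_Q, map_add, map_mul, pderiv_mul, h₀, h₁, h₂, h₃,
    h₄, h₅, h₆]

/-- A conic whose coefficients are polynomials in a parameter is a polynomial curve. -/
theorem isPolyCurve_conic (h a b c d e : ℂ[X]) :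
    IsPolyCurve fun s => (conic (h.eval s) (a.eval s) (b.eval s) (c.eval s) (d.eval s) (e.eval s) :
      Poly) :=
  (((((((IsPolyCurve.C_eval h).mul (.const _)).add ((IsPolyCurve.C_eval a).mul (.const _))).add
    ((IsPolyCurve.C_eval b).mul (.const _))).add ((IsPolyCurve.C_eval c).mul (.const _))).add
    ((IsPolyCurve.C_eval d).mul (.const _))).add ((IsPolyCurve.C_eval e).mul (.const _)))

theorem IsPolyCurve.diffForm_P {L M U V : ℂ → Quad} (hL : IsPolyCurve fun s => (L s : Poly))
    (hM : IsPolyCurve fun s => (M s : Poly)) (hU : IsPolyCurve fun s => (U s : Poly))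
    (hV : IsPolyCurve fun s => (V s : Poly)) :
    IsPolyCurve fun s => (diffForm (L s) (M s) (U s) (V s)).P :=
  (hL.mul (hU.pderiv 0)).add (hM.mul (hV.pderiv 0))

theorem IsPolyCurve.diffForm_Q {L M U V : ℂ → Quad} (hL : IsPolyCurve fun s => (L s : Poly))
    (hM : IsPolyCurve fun s => (M s : Poly)) (hU : IsPolyCurve fun s => (U s : Poly))
    (hV : IsPolyCurve fun s => (V s : Poly)) :
    IsPolyCurve fun s => (diffForm (L s) (M s) (U s) (V s)).Q :=
  (hL.mul (hU.pderiv 1)).add (hM.mul (hV.pderiv 1))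

theorem IsPolyCurve.smul_quad {f : ℂ → Quad} (hf : IsPolyCurve fun s => (f s : Poly)) (r : ℂ) :
    IsPolyCurve fun s => ((r • f s : Quad) : Poly) := by
  simpa only [Submodule.coe_smul, smul_eq_C_mul] using (IsPolyCurve.const (C r)).mul hf

-- Irreducibility keeps unification from comparing polynomials by unfolding; the lemmas above are
-- the interface.
attribute [irreducible] conic diffForm

/-! ### Forms with two integral conics -/

/-- The conics `F` and `G` are integral curves of `β G dF + α F dG`. -/
theorem mem_X_of_inGeneralPosition {α β : ℂ} {F G : Quad} (hF : (F : Poly) ≠ 0)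
    (hG : (G : Poly) ≠ 0) (hFG : InGeneralPosition ![(F : Poly), (G : Poly)])
    (hP : (diffForm (β • G) (α • F) F G).IsPoincare) :
    diffForm (β • G) (α • F) F G ∈ X 3 ![2, 2] := by
  have hJ : (pderiv 0 (G : Poly) * pderiv 1 (F : Poly)
      - pderiv 1 (G : Poly) * pderiv 0 (F : Poly)).IsHomogeneous 2 :=
    ((IsHomogeneous.pderiv G.2).mul (IsHomogeneous.pderiv F.2)).sub
      ((IsHomogeneous.pderiv G.2).mul (IsHomogeneous.pderiv F.2))
  refine ⟨⟨![F, G], ?_, hFG, ?_⟩, hP⟩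
  · intro i
    fin_cases i
    · exact F.2
    · exact G.2
  · intro i
    fin_cases i
    · refine ⟨_, hF, ⟨2, two_pos, F.2⟩, (hJ.C_mul (-α)), ?_⟩
      simp [diffForm_P, diffForm_Q, smul_eq_C_mul]
      ring
    · refine ⟨_, hG, ⟨2, two_pos, G.2⟩, (hJ.C_mul β), ?_⟩
      simp [diffForm_P, diffForm_Q, smul_eq_C_mul]
      ring

/-- Along a polynomial curve of pairs of nonzero conics with Poincaré form `β G dF + α F dG`, it
is enough to find one pair in general position. -/
theorem mem_zariskiClosure_X {α β : ℂ} {F G : ℂ → Quad} (hFc : IsPolyCurve fun s => (F s : Poly))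
    (hGc : IsPolyCurve fun s => (G s : Poly)) (hF : ∀ s, (F s : Poly) ≠ 0)
    (hG : ∀ s, (G s : Poly) ≠ 0)
    (hP : ∀ s, (diffForm (β • G s) (α • F s) (F s) (G s)).IsPoincare)
    {s₀ : ℂ} (hFG : InGeneralPosition ![(F s₀ : Poly), (G s₀ : Poly)]) (s : ℂ) :
    diffForm (β • G s) (α • F s) (F s) (G s) ∈ zariskiClosure (X 3 ![2, 2]) := by
  refine mem_zariskiClosure_of_infinite (fun s => diffForm (β • G s) (α • F s) (F s) (G s))
    (.diffForm_P (hGc.smul_quad β) (hFc.smul_quad α) hFc hGc)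
    (.diffForm_Q (hGc.smul_quad β) (hFc.smul_quad α) hFc hGc) ?_ s
  have hev : ∀ᶠ s in 𝓝 s₀, InGeneralPosition ![(F s : Poly), (G s : Poly)] := by
    refine eventually_inGeneralPosition (e := ![2, 2]) (F := fun s => ![(F s : Poly), (G s : Poly)])
      ?_ ?_ hFG
    · intro i
      fin_cases i
      · exact hFc
      · exact hGc
    · intro s i
      fin_cases i
      · exact (F s).2
      · exact (G s).2
  exact infinite_of_mem_nhds s₀ (hev.mono fun s hs =>
    mem_X_of_inGeneralPosition (hF s) (hG s) hs (hP s))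

/-! ### Pairs of conics away from the critical point -/

theorem inGeneralPosition_pair {F G : Poly}
    (hF : ∀ v, v ≠ 0 → eval v F = 0 → gradient F v ≠ 0)
    (hG : ∀ v, v ≠ 0 → eval v G = 0 → gradient G v ≠ 0)
    (hF' : ∀ v, v ≠ 0 → v 2 = 0 → eval v F = 0 → gradient F v 0 ≠ 0 ∨ gradient F v 1 ≠ 0)
    (hG' : ∀ v, v ≠ 0 → v 2 = 0 → eval v G = 0 → gradient G v 0 ≠ 0 ∨ gradient G v 1 ≠ 0)
    (hFG : ∀ v, v ≠ 0 → eval v F = 0 → eval v G = 0 →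
      crossProduct (gradient F v) (gradient G v) ≠ 0)
    (hFG' : ∀ v, v ≠ 0 → v 2 = 0 → eval v F = 0 → eval v G ≠ 0) :
    InGeneralPosition ![F, G] := by
  have hinf : ∀ g : Fin 3 → ℂ, g 0 ≠ 0 ∨ g 1 ≠ 0 → LinearIndependent ℂ ![g, ![0, 0, 1]] := by
    intro g hg
    refine crossProduct_ne_zero_iff_linearIndependent.1 fun h => ?_
    have h₀ := congrFun h 0
    have h₁ := congrFun h 1
    simp [cross_apply] at h₀ h₁
    tauto
  constructor
  · intro i
    fin_cases i
    · exact hF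
    · exact hG
  · intro i v hv hv2
    fin_cases i
    · exact fun h => hinf _ (hF' v hv hv2 h)
    · exact fun h => hinf _ (hG' v hv hv2 h)
  · intro i j hij v hv
    fin_cases i <;> fin_cases j
    · exact absurd rfl hij
    · exact fun h h' => crossProduct_ne_zero_iff_linearIndependent.1 (hFG v hv h h')
    · intro h h'
      refine crossProduct_ne_zero_iff_linearIndependent.1 fun h0 => hFG v hv h' h ?_
      rw [← neg_cross] at h0
      exact neg_eq_zero.1 h0
    · exact absurd rfl hij
  · intro i j hij v hv hv2
    fin_cases i <;> fin_cases j
    · exact absurd rfl hij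
    · exact fun h => hFG' v hv hv2 h.1 h.2
    · exact fun h => hFG' v hv hv2 h.2 h.1
    · exact absurd rfl hij
  · intro i j k hij hik hjk
    omega

theorem inGeneralPosition_diagonal {a b a' b' : ℂ} (ha : a ≠ 0) (hb : b ≠ 0) (ha' : a' ≠ 0)
    (hb' : b' ≠ 0) (haa : a ≠ a') (hbb : b ≠ b') (hab : a * b' - a' * b ≠ 0) :
    InGeneralPosition ![(conic 1 0 0 a 0 b : Poly), (conic 1 0 0 a' 0 b' : Poly)] := by
  have ext3 : ∀ {v : Fin 3 → ℂ}, v 0 = 0 → v 1 = 0 → v 2 = 0 → v = 0 := by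
    intro v h0 h1 h2
    ext i
    fin_cases i <;> assumption
  have smooth : ∀ {a b : ℂ}, a ≠ 0 → b ≠ 0 → ∀ v : Fin 3 → ℂ, v ≠ 0 →
      eval v (conic 1 0 0 a 0 b : Poly) = 0 → gradient (conic 1 0 0 a 0 b : Poly) v ≠ 0 := by
    intro a b ha hb v hv _ h
    have h0 := congrFun h 0
    have h1 := congrFun h 1
    have h2 := congrFun h 2
    simp [gradient_conic, ha, hb] at h0 h1 h2
    exact hv (ext3 h0 h1 h2)
  have infinity : ∀ {a b : ℂ}, a ≠ 0 → b ≠ 0 → ∀ v : Fin 3 → ℂ, v ≠ 0 → v 2 = 0 →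
      eval v (conic 1 0 0 a 0 b : Poly) = 0 → gradient (conic 1 0 0 a 0 b : Poly) v 0 ≠ 0 ∨
        gradient (conic 1 0 0 a 0 b : Poly) v 1 ≠ 0 := by
    intro a b ha hb v hv h2 _
    by_contra! h
    simp [gradient_conic, ha, hb] at h
    exact hv (ext3 h.1 h.2 h2)
  refine inGeneralPosition_pair (smooth ha hb) (smooth ha' hb') (infinity ha hb)
    (infinity ha' hb') ?_ ?_
  · intro v hv hF hG h
    have h0 := congrFun h 0
    have h1 := congrFun h 1
    have h2 := congrFun h 2
    simp only [gradient_conic, cross_apply, eval_conic] at h0 h1 h2 hF hG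
    simp at h0 h1 h2 hF hG
    have e0 : (b - b') * (v 1 * v 2) = 0 := by linear_combination h0 / 4
    have e1 : (a - a') * (v 0 * v 2) = 0 := by linear_combination -h1 / 4
    have e2 : (a * b' - a' * b) * (v 0 * v 1) = 0 := by linear_combination h2 / 4
    simp only [mul_eq_zero, sub_ne_zero.2 hbb, sub_ne_zero.2 haa, hab, false_or] at e0 e1 e2
    rcases e0 with e | e <;> rcases e1 with e' | e' <;> rcases e2 with e'' | e'' <;>
      simp_all
  · intro v hv h2 hF hG
    simp [eval_conic, h2] at hF hG
    have e0 : (a * b' - a' * b) * v 0 ^ 2 = 0 := by linear_combination b' * hF - b * hG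
    have e1 : (a * b' - a' * b) * v 1 ^ 2 = 0 := by linear_combination a * hG - a' * hF
    simp [hab] at e0 e1
    exact hv (ext3 e0 e1 h2)

/-- The critical point lies on neither conic. Vanishing of the linear part of `β G dF - α F dG`
makes the linear terms of `F / F(0)` and `G / G(0)` proportional to `α` and `β`; the quadratic part
is the only other constraint, so that the pair can be moved to a pair of diagonal conics. -/
theorem diffForm_mem_of_eval_ne_zero {α β a b f₁ f₂ f₃ f₄ f₅ g₁ g₂ g₃ g₄ g₅ : ℂ} (hα : α ≠ 0)
    (hβ : β ≠ 0) (hf₁ : f₁ = α * a) (hf₂ : f₂ = α * b) (hg₁ : g₁ = β * a) (hg₂ : g₂ = β * b)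
    (h₃ : β * f₃ - α * g₃ + α * β * (β - α) * a ^ 2 / 2 = 1 / 2)
    (h₄ : β * f₄ - α * g₄ + α * β * (β - α) * (a * b) = 0)
    (h₅ : β * f₅ - α * g₅ + α * β * (β - α) * b ^ 2 / 2 = 1 / 2) :
    diffForm (β • conic 1 g₁ g₂ g₃ g₄ g₅) (-α • conic 1 f₁ f₂ f₃ f₄ f₅)
      (conic 1 f₁ f₂ f₃ f₄ f₅) (conic 1 g₁ g₂ g₃ g₄ g₅) ∈ zariskiClosure (X 3 ![2, 2]) := by
  obtain ⟨p, hp⟩ := Infinite.exists_notMem_finset ({0, 1 / (2 * β), 1 / (2 * (β - α))} : Finset ℂ)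
  obtain ⟨q, hq⟩ :=
    Infinite.exists_notMem_finset ({0, 1 / (2 * β), 1 / (2 * (β - α)), p} : Finset ℂ)
  simp only [Finset.mem_insert, Finset.mem_singleton, not_or] at hp hq
  have hβ2 : 2 * β ≠ 0 := mul_ne_zero two_ne_zero hβ
  have notzero : ∀ {t : ℂ}, t ≠ 1 / (2 * β) → α⁻¹ * (β * t - 1 / 2) ≠ 0 := by
    intro t ht h
    refine ht ?_
    rw [eq_div_iff hβ2]
    linear_combination 2 * (mul_eq_zero.1 h).resolve_left (inv_ne_zero hα)
  have distinct : ∀ {t : ℂ}, t ≠ 1 / (2 * (β - α)) → t ≠ α⁻¹ * (β * t - 1 / 2) := by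
    intro t ht h
    have h' : (2 * (β - α)) * t = 1 := by
      rw [eq_inv_mul_iff_mul_eq₀ hα] at h
      linear_combination -2 * h
    refine ht ?_
    rw [eq_div_iff (left_ne_zero_of_mul_eq_one h')]
    linear_combination h'
  let A : ℂ[X] := .C a * (1 - .X)
  let B : ℂ[X] := .C b * (1 - .X)
  let F₃ : ℂ[X] := .C f₃ + .C (p - f₃) * .X
  let F₄ : ℂ[X] := .C f₄ + .C (-f₄) * .X
  let F₅ : ℂ[X] := .C f₅ + .C (q - f₅) * .X
  let G₃ : ℂ[X] := .C α⁻¹ * (.C β * F₃ + .C (α * β * (β - α) / 2) * A ^ 2 - .C (1 / 2))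
  let G₄ : ℂ[X] := .C α⁻¹ * (.C β * F₄ + .C (α * β * (β - α)) * (A * B))
  let G₅ : ℂ[X] := .C α⁻¹ * (.C β * F₅ + .C (α * β * (β - α) / 2) * B ^ 2 - .C (1 / 2))
  let F : ℂ → Quad := fun s => conic ((1 : ℂ[X]).eval s) ((.C α * A).eval s) ((.C α * B).eval s)
    (F₃.eval s) (F₄.eval s) (F₅.eval s)
  let G : ℂ → Quad := fun s => conic ((1 : ℂ[X]).eval s) ((.C β * A).eval s) ((.C β * B).eval s)
    (G₃.eval s) (G₄.eval s) (G₅.eval s)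
  have hF₀ : F 0 = conic 1 f₁ f₂ f₃ f₄ f₅ := by
    simp [F, A, B, F₃, F₄, F₅, hf₁, hf₂]
  have hG₀ : G 0 = conic 1 g₁ g₂ g₃ g₄ g₅ := by
    have e₃ : α⁻¹ * (β * f₃ + α * β * (β - α) / 2 * a ^ 2 - 1 / 2) = g₃ := by
      rw [inv_mul_eq_iff_eq_mul₀ hα]
      linear_combination h₃
    have e₄ : α⁻¹ * (β * f₄ + α * β * (β - α) * (a * b)) = g₄ := by
      rw [inv_mul_eq_iff_eq_mul₀ hα]
      linear_combination h₄
    have e₅ : α⁻¹ * (β * f₅ + α * β * (β - α) / 2 * b ^ 2 - 1 / 2) = g₅ := by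
      rw [inv_mul_eq_iff_eq_mul₀ hα]
      linear_combination h₅
    rw [← e₃, ← e₄, ← e₅, hg₁, hg₂]
    simp [G, G₃, G₄, G₅, A, B, F₃, F₄, F₅]
  rw [← hF₀, ← hG₀]
  have hne : ∀ u₁ u₂ u₃ u₄ u₅ : ℂ, (conic 1 u₁ u₂ u₃ u₄ u₅ : Poly) ≠ 0 := by
    intro u₁ u₂ u₃ u₄ u₅ h
    have := congrArg (eval ![0, 0, 1]) h
    simp [eval_conic] at this
  refine mem_zariskiClosure_X (s₀ := 1) (isPolyCurve_conic _ _ _ _ _ _)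
    (isPolyCurve_conic _ _ _ _ _ _) (fun s => ?_) (fun s => ?_) (fun s => ?_) ?_ 0
  · simpa [F] using hne _ _ _ _ _
  · simpa [G] using hne _ _ _ _ _
  · simp only [G₃, G₄, G₅, smul_conic, isPoincare_diffForm_iff, Polynomial.eval_mul,
      Polynomial.eval_add, Polynomial.eval_sub, Polynomial.eval_C, Polynomial.eval_pow,
      Polynomial.eval_one]
    refine ⟨?_, ?_, ?_, ?_, ?_, ?_⟩ <;> field_simp <;> ring
  · have hF₁ : F 1 = conic 1 0 0 p 0 q := by simp [F, A, B, F₃, F₄, F₅]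
    have hG₁ : G 1 = conic 1 0 0 (α⁻¹ * (β * p - 1 / 2)) 0 (α⁻¹ * (β * q - 1 / 2)) := by
      simp [G, G₃, G₄, G₅, A, B, F₃, F₄, F₅]
    change InGeneralPosition ![(F 1 : Poly), (G 1 : Poly)]
    rw [hF₁, hG₁]
    refine inGeneralPosition_diagonal hp.1 hq.1 (notzero hp.2.1) (notzero hq.2.1)
      (distinct hp.2.2) (distinct hq.2.2.1) ?_
    rw [show p * (α⁻¹ * (β * q - 1 / 2)) - α⁻¹ * (β * p - 1 / 2) * q = α⁻¹ / 2 * (q - p) by ring]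
    exact mul_ne_zero (div_ne_zero (inv_ne_zero hα) two_ne_zero) (sub_ne_zero.2 hq.2.2.2)

/-! ### Pairs of conics that meet at the critical point -/

theorem inGeneralPosition_crossing :
    InGeneralPosition ![(conic 0 1 Complex.I 2 (-2 * Complex.I) 0 : Poly),
      (conic 0 1 (-Complex.I) 0 (-2 * Complex.I) 2 : Poly)] := by
  -- In the coordinates `u = x + i y`, `v = x - i y` the conics are `u z + u v + v²` and
  -- `v z + u v - u²`.
  have hI : Complex.I ^ 2 = -1 := Complex.I_sq
  have ext3 : ∀ {v : Fin 3 → ℂ}, v 0 + Complex.I * v 1 = 0 → v 0 - Complex.I * v 1 = 0 →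
      v 2 = 0 → v = 0 := by
    intro v h0 h1 h2
    have e0 : v 0 = 0 := by linear_combination (h0 + h1) / 2
    have e1 : v 1 = 0 := by simpa [e0] using h0
    ext i
    fin_cases i <;> assumption
  refine inGeneralPosition_pair ?_ ?_ ?_ ?_ ?_ ?_
  · intro v hv _ h
    have h0 := congrFun h 0
    have h1 := congrFun h 1
    have h2 := congrFun h 2
    simp [gradient_conic] at h0 h1 h2
    have e : v 0 - Complex.I * v 1 = 0 := by
      linear_combination ((h0 + Complex.I * h1) / 2 - h2) / 2 - (v 2 - 2 * v 0) / 4 * hI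
    refine hv (ext3 h2 e ?_)
    linear_combination (h0 - Complex.I * h1) / 2 - e - (2 * v 0 - v 2) / 2 * hI
  · intro v hv _ h
    have h0 := congrFun h 0
    have h1 := congrFun h 1
    have h2 := congrFun h 2
    simp [gradient_conic] at h0 h1 h2
    have e : v 0 + Complex.I * v 1 = 0 := by
      linear_combination (h2 - (h0 - Complex.I * h1) / 2) / 2 + (2 * v 0 + v 2) / 4 * hI
    refine hv (ext3 e (by linear_combination h2) ?_)
    linear_combination (h0 + Complex.I * h1) / 2 - e + (2 * v 0 + v 2) / 2 * hI
  · intro v hv h2 _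
    by_contra! h
    simp [gradient_conic] at h
    have e0 : v 0 = 0 := by simpa [h2] using h.2
    have e1 : v 1 = 0 := by simpa [h2, e0] using h.1
    exact hv (ext3 (by simp [e0, e1]) (by simp [e0, e1]) h2)
  · intro v hv h2 _
    by_contra! h
    simp [gradient_conic] at h
    have e1 : v 1 = 0 := by simpa [h2] using h.1
    have e0 : v 0 = 0 := by simpa [h2, e1] using h.2
    exact hv (ext3 (by simp [e0, e1]) (by simp [e0, e1]) h2)
  · intro v hv hF hG h
    have h0 := congrFun h 0
    have h1 := congrFun h 1
    have h2 := congrFun h 2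
    simp only [gradient_conic, cross_apply, eval_conic] at h0 h1 h2 hF hG
    simp at h0 h1 h2 hF hG
    obtain ⟨u, hu⟩ : ∃ u, u = v 0 + Complex.I * v 1 := ⟨_, rfl⟩
    obtain ⟨w, hw⟩ : ∃ w, w = v 0 - Complex.I * v 1 := ⟨_, rfl⟩
    have eF : u * v 2 + u * w + w ^ 2 = 0 := by
      rw [hu, hw]
      linear_combination hF
    have eG : w * v 2 + u * w - u ^ 2 = 0 := by
      rw [hu, hw]
      linear_combination hG - 2 * v 1 ^ 2 * hI
    have e : u * (w - 2 * u) - (v 2 + w) * w = 0 := by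
      rw [hu, hw]
      linear_combination (h1 + Complex.I * h0) / 2
        - (v 2 * v 0 + 2 * Complex.I * v 0 * v 1) * hI
    by_cases hu0 : u = 0
    · have hw0 : w = 0 := by simpa [hu0] using eF
      have e0 : v 0 = 0 := by linear_combination (hu0 + hw0 - hu - hw) / 2
      have e1 : v 1 = 0 := by simpa [e0, hu0] using hu
      refine hv (ext3 (hu ▸ hu0) (hw ▸ hw0) ?_)
      have e2 : Complex.I * v 2 ^ 2 = 0 := by
        rw [e0, e1] at h2
        linear_combination -h2 / 2
      simpa using e2
    · have k₁ : u * (w ^ 2 - 2 * u * w + 3 * u ^ 2) = 0 := by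
        linear_combination w * eF - u * eG - (u * e + w * eF)
      have k₁ := (mul_eq_zero.1 k₁).resolve_left hu0
      have k₂ : u * (w ^ 2 - u * w - u ^ 2) = 0 := by
        linear_combination (u * e + w * eF) / 2 - w / 2 * k₁
      have k₂ := (mul_eq_zero.1 k₂).resolve_left hu0
      have k₃ : u * (w - 4 * u) = 0 := by linear_combination k₂ - k₁
      have k₃ := (mul_eq_zero.1 k₃).resolve_left hu0
      have k₄ : u ^ 2 = 0 := by linear_combination (k₂ - (w + 3 * u) * k₃) / 11
      exact hu0 (by simpa using k₄)
  · intro v hv h2 hF hG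
    simp [eval_conic, h2] at hF hG
    have e0 : v 0 ^ 2 - Complex.I * v 0 * v 1 = 0 := by linear_combination hF / 2
    have e1 : v 1 ^ 2 - Complex.I * v 0 * v 1 = 0 := by linear_combination hG / 2
    rcases mul_eq_zero.1 (show v 0 * (v 0 - Complex.I * v 1) = 0 by linear_combination e0)
      with h | h
    · have e : v 1 = 0 := by simpa [h] using e1
      exact hv (ext3 (by simp [h, e]) (by simp [h, e]) h2)
    · have e : v 1 ^ 2 = 0 := by
        linear_combination e1 / 2 + Complex.I * v 1 * h / 2 + v 1 ^ 2 / 2 * hI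
      have e : v 1 = 0 := by simpa using e
      exact hv (ext3 (by linear_combination h + 2 * Complex.I * e) h h2)

/-- The critical point is a transversal intersection of `F` and `G`, and the form is
`d (F G) / 2`. -/
theorem diffForm_mem_of_crossing {f₀ f₁ f₂ f₃ f₄ f₅ g₀ g₁ g₂ g₃ g₄ g₅ : ℂ} (hf₀ : f₀ = 0)
    (hf₁ : f₁ = 1) (hf₂ : f₂ = Complex.I) (hg₀ : g₀ = 0) (hg₁ : g₁ = 1) (hg₂ : g₂ = -Complex.I) :
    diffForm ((1 / 2 : ℂ) • conic g₀ g₁ g₂ g₃ g₄ g₅) ((1 / 2 : ℂ) • conic f₀ f₁ f₂ f₃ f₄ f₅)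
      (conic f₀ f₁ f₂ f₃ f₄ f₅) (conic g₀ g₁ g₂ g₃ g₄ g₅) ∈ zariskiClosure (X 3 ![2, 2]) := by
  subst hf₀ hf₁ hf₂ hg₀ hg₁ hg₂
  have hne : ∀ u₂ u₃ u₄ u₅ : ℂ, (conic 0 1 u₂ u₃ u₄ u₅ : Poly) ≠ 0 := by
    intro u₂ u₃ u₄ u₅ h
    have := congrArg (fun F => eval ![0, 0, 1] (pderiv 0 F)) h
    simp [pderiv_zero_conic] at this
  have segment : ∀ u₂ u₃ u₄ u₅ w₃ w₄ w₅ : ℂ, IsPolyCurve fun s =>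
      (conic 0 1 u₂ (u₃ + w₃ * s) (u₄ + w₄ * s) (u₅ + w₅ * s) : Poly) := by
    intro u₂ u₃ u₄ u₅ w₃ w₄ w₅
    simpa using isPolyCurve_conic 0 1 (.C u₂) (.C u₃ + .C w₃ * .X) (.C u₄ + .C w₄ * .X)
      (.C u₅ + .C w₅ * .X)
  have key := mem_zariskiClosure_X (α := 1 / 2) (β := 1 / 2) (s₀ := 1)
    (segment Complex.I f₃ f₄ f₅ (2 - f₃) (-2 * Complex.I - f₄) (0 - f₅))
    (segment (-Complex.I) g₃ g₄ g₅ (0 - g₃) (-2 * Complex.I - g₄) (2 - g₅))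
    (fun s => hne _ _ _ _) (fun s => hne _ _ _ _) (fun s => ?_) ?_ 0
  · simpa using key
  · simp only [smul_conic, isPoincare_diffForm_iff]
    refine ⟨by ring, by ring, by ring, ?_, by ring, by ring⟩
    linear_combination -Complex.I_sq
  · simpa using inGeneralPosition_crossing

/-! ### Pullbacks of linear vector fields under quadratic maps -/

/-- The monomial `z²`. -/
noncomputable def zSq : Quad := conic 1 0 0 0 0 0

theorem pderiv_zero_zSq : pderiv 0 (zSq : Poly) = 0 := by simp [zSq, pderiv_zero_conic]

theorem pderiv_one_zSq : pderiv 1 (zSq : Poly) = 0 := by simp [zSq, pderiv_one_conic]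

/-- The pullback of the form `(p₀ + p₁ u + p₂ v) du + (q₀ + q₁ u + q₂ v) dv` under the map
`(x, y) ↦ (U, V)`, where `U`, `V` are quadratic. -/
noncomputable def linForm (p₀ p₁ p₂ q₀ q₁ q₂ : ℂ) (U V : Quad) : Form 3 :=
  diffForm (p₀ • zSq + p₁ • U + p₂ • V) (q₀ • zSq + q₁ • U + q₂ • V) U V

theorem linForm_swap (p₀ p₁ p₂ q₀ q₁ q₂ : ℂ) (U V : Quad) :
    linForm p₀ p₁ p₂ q₀ q₁ q₂ U V = linForm q₀ q₂ q₁ p₀ p₂ p₁ V U := by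
  rw [linForm, diffForm_swap, add_right_comm, add_right_comm (p₀ • zSq), linForm]

/-- Constants may be added to `U` and `V`. -/
theorem linForm_add_zSq (p₀ p₁ p₂ q₀ q₁ q₂ u v : ℂ) (U V : Quad) :
    linForm p₀ p₁ p₂ q₀ q₁ q₂ (u • zSq + U) (v • zSq + V)
      = linForm (p₀ + p₁ * u + p₂ * v) p₁ p₂ (q₀ + q₁ * u + q₂ * v) q₁ q₂ U V := by
  refine Form.ext_PQ ?_ ?_ <;>
  · simp only [linForm, diffForm_P, diffForm_Q, Submodule.coe_add, Submodule.coe_smul,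
      Derivation.map_add, smul_eq_C_mul, pderiv_C_mul, pderiv_zero_zSq, pderiv_one_zSq, C_mul,
      C_add]
    ring

/-- A linear substitution in `(u, v)` that turns `p₀ du + q₀ dv` into `du`. -/
theorem linForm_eq_of_ne_zero {p₀ p₁ p₂ q₀ q₁ q₂ r : ℂ} (hr : r * p₀ = 1) (U V : Quad) :
    linForm p₀ p₁ p₂ q₀ q₁ q₂ U V
      = linForm 1 (r ^ 2 * p₁) (r * p₂ - r ^ 2 * q₀ * p₁) 0 (r * (q₁ - r * q₀ * p₁))
        (q₂ - r * q₀ * p₂ - r * q₀ * (q₁ - r * q₀ * p₁)) (p₀ • U + q₀ • V) V := by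
  have h : C r * C p₀ = (1 : Poly) := by rw [← C_mul, hr, C_1]
  refine Form.ext_PQ ?_ ?_
  · simp only [linForm, diffForm_P, Submodule.coe_add, Submodule.coe_smul, Derivation.map_add,
      smul_eq_C_mul, pderiv_C_mul]
    simp only [C_mul, C_sub, C_pow, C_1, C_0]
    linear_combination -(C p₁ * (C r * C p₀ + 1) * U * pderiv 0 (U : Poly)
      + C p₂ * V * pderiv 0 (U : Poly) + C q₁ * U * pderiv 0 (V : Poly)) * h
  · simp only [linForm, diffForm_Q, Submodule.coe_add, Submodule.coe_smul, Derivation.map_add,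
      smul_eq_C_mul, pderiv_C_mul]
    simp only [C_mul, C_sub, C_pow, C_1, C_0]
    linear_combination -(C p₁ * (C r * C p₀ + 1) * U * pderiv 1 (U : Poly)
      + C p₂ * V * pderiv 1 (U : Poly) + C q₁ * U * pderiv 1 (V : Poly)) * h

/-- If the linear vector field has two eigenvalues `l`, `m` that are distinct and nonzero, its
eigenlines are the two lines `1 + l (r u + v) = 0` and `1 + m (s u + v) = 0`, and the form is a
combination of the equations of these lines. -/
theorem linForm_eq_diffForm_of_eigenvalues {p₁ p₂ q₁ q₂ l m : ℂ} (hq : q₂ ≠ 0) (hlm : m - l ≠ 0)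
    (htr : p₂ - q₁ = l + m) (hdet : p₁ * q₂ - q₁ * p₂ = l * m) {r s D : ℂ}
    (hr : r = (p₂ - l) / q₂) (hs : s = (p₂ - m) / q₂) (hD : D = l * m * (m - l) / q₂)
    (hl : l ≠ 0) (hm : m ≠ 0) (U V : Quad) :
    linForm 1 p₁ p₂ 0 q₁ q₂ U V
      = diffForm ((m / D) • ((1 : ℂ) • zSq + (m * s) • U + m • V))
        (-(l / D) • ((1 : ℂ) • zSq + (l * r) • U + l • V))
        ((1 : ℂ) • zSq + (l * r) • U + l • V) ((1 : ℂ) • zSq + (m * s) • U + m • V) := by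
  obtain ⟨κ, hκ⟩ : ∃ κ, κ = q₂ / (m - l) := ⟨_, rfl⟩
  have hβ : m / D = κ / l := by rw [hD, hκ]; field_simp
  have hα : l / D = κ / m := by rw [hD, hκ]; field_simp
  have e₀ : κ * (r - s) = 1 := by rw [hκ, hr, hs]; field_simp; ring
  have e₁ : p₁ = κ * (m - l) * (r * s) := by
    rw [hκ, hr, hs]
    field_simp
    linear_combination hdet - p₂ * htr
  have e₂ : p₂ = κ * (m * r - l * s) := by rw [hκ, hr, hs]; field_simp; ring
  have e₃ : q₁ = κ * (m * s - l * r) := by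
    rw [hκ, hr, hs]
    field_simp
    linear_combination (l - m) * htr
  have e₄ : q₂ = κ * (m - l) := by rw [hκ]; field_simp
  have hl' : κ / l * l = κ := div_mul_cancel₀ _ hl
  have hm' : κ / m * m = κ := div_mul_cancel₀ _ hm
  rw [hβ, hα]
  generalize κ / l = κl at hl'
  generalize κ / m = κm at hm'
  clear hr hs hD hκ hβ hα
  subst e₁ e₂ e₃ e₄
  have e₀ : C κ * (C r - C s) = (1 : Poly) := by rw [← C_sub, ← C_mul, e₀, C_1]
  have hl' : C κl * C l = (C κ : Poly) := by rw [← C_mul, hl']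
  have hm' : C κm * C m = (C κ : Poly) := by rw [← C_mul, hm']
  refine Form.ext_PQ ?_ ?_
  · simp only [linForm, diffForm_P, Submodule.coe_add, Submodule.coe_smul, Derivation.map_add,
      smul_eq_C_mul, pderiv_C_mul, pderiv_zero_zSq]
    simp only [C_mul, C_sub, C_1, C_0, C_neg]
    linear_combination -((zSq : Poly) * pderiv 0 (U : Poly)) * e₀
      - (zSq + C m * C s * U + C m * V) * (C r * pderiv 0 (U : Poly) + pderiv 0 (V : Poly)) * hl'
      + (zSq + C l * C r * U + C l * V) * (C s * pderiv 0 (U : Poly) + pderiv 0 (V : Poly)) * hm'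
  · simp only [linForm, diffForm_Q, Submodule.coe_add, Submodule.coe_smul, Derivation.map_add,
      smul_eq_C_mul, pderiv_C_mul, pderiv_one_zSq]
    simp only [C_mul, C_sub, C_1, C_0, C_neg]
    linear_combination -((zSq : Poly) * pderiv 1 (U : Poly)) * e₀
      - (zSq + C m * C s * U + C m * V) * (C r * pderiv 1 (U : Poly) + pderiv 1 (V : Poly)) * hl'
      + (zSq + C l * C r * U + C l * V) * (C s * pderiv 1 (U : Poly) + pderiv 1 (V : Poly)) * hm'

/-- The quadratic polynomial `(x² + y² - q (a x + b y)²) / 2`. -/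
noncomputable def foldQuad (q a b : ℂ) : Quad :=
  conic 0 0 0 (1 / 2 - q * (a ^ 2 / 2)) (-(q * (a * b))) (1 / 2 - q * (b ^ 2 / 2))

theorem zSq_add_smul_foldQuad (q a b c d e t w : ℂ) :
    (1 : ℂ) • zSq + t • foldQuad q a b + w • conic 0 a b c d e
      = conic 1 (w * a) (w * b) (t * (1 / 2 - q * (a ^ 2 / 2)) + w * c)
        (t * -(q * (a * b)) + w * d) (t * (1 / 2 - q * (b ^ 2 / 2)) + w * e) := by
  simp only [zSq, foldQuad, smul_conic, conic_add, mul_zero, add_zero, mul_one, zero_add]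

theorem smul_conic_add_smul_conic (t w u₁ u₂ u₃ u₄ u₅ v₁ v₂ v₃ v₄ v₅ : ℂ) :
    t • conic 0 u₁ u₂ u₃ u₄ u₅ + w • conic 0 v₁ v₂ v₃ v₄ v₅
      = conic 0 (t * u₁ + w * v₁) (t * u₂ + w * v₂) (t * u₃ + w * v₃) (t * u₄ + w * v₄)
        (t * u₅ + w * v₅) := by
  simp only [smul_conic, conic_add, mul_zero, add_zero]

theorem linForm_foldQuad_mem_of_ne_zero {p₁ p₂ q₁ q₂ a b c d e : ℂ} (hq : q₂ ≠ 0)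
    (hdet : p₁ * q₂ - q₁ * p₂ ≠ 0) (hdisc : (p₂ - q₁) ^ 2 - 4 * (p₁ * q₂ - q₁ * p₂) ≠ 0) :
    linForm 1 p₁ p₂ 0 q₁ q₂ (foldQuad q₂ a b) (conic 0 a b c d e)
      ∈ zariskiClosure (X 3 ![2, 2]) := by
  obtain ⟨δ, hδ⟩ := IsAlgClosed.exists_pow_nat_eq
    ((p₂ - q₁) ^ 2 - 4 * (p₁ * q₂ - q₁ * p₂)) two_pos
  have hδ0 : δ ≠ 0 := by
    rintro rfl
    exact hdisc (by rw [← hδ]; simp)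
  -- the eigenvalues
  obtain ⟨l, hl⟩ : ∃ l, l = (p₂ - q₁ - δ) / 2 := ⟨_, rfl⟩
  obtain ⟨m, hm⟩ : ∃ m, m = (p₂ - q₁ + δ) / 2 := ⟨_, rfl⟩
  have htr : p₂ - q₁ = l + m := by rw [hl, hm]; ring
  have hlm : p₁ * q₂ - q₁ * p₂ = l * m := by
    rw [hl, hm]
    linear_combination hδ / 4
  have hml : m - l ≠ 0 := by
    rw [hl, hm]
    ring_nf
    exact hδ0
  rw [hlm] at hdet
  have hl0 := left_ne_zero_of_mul hdet
  have hm0 := right_ne_zero_of_mul hdet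
  obtain ⟨r, hr⟩ : ∃ r, r = (p₂ - l) / q₂ := ⟨_, rfl⟩
  obtain ⟨s, hs⟩ : ∃ s, s = (p₂ - m) / q₂ := ⟨_, rfl⟩
  obtain ⟨D, hD⟩ : ∃ D, D = l * m * (m - l) / q₂ := ⟨_, rfl⟩
  have hD0 : D ≠ 0 := hD ▸ div_ne_zero (mul_ne_zero hdet hml) hq
  have hmsr : m / D * (l * r) - l / D * (m * s) = 1 := by
    rw [hD, hr, hs]
    field_simp
    ring
  have hsq : l / D * (m / D) * (m / D - l / D) * D ^ 2 = q₂ := by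
    rw [hD]
    field_simp
  rw [linForm_eq_diffForm_of_eigenvalues hq hml htr hlm hr hs hD hl0 hm0,
    zSq_add_smul_foldQuad, zSq_add_smul_foldQuad]
  refine diffForm_mem_of_eval_ne_zero (a := D * a) (b := D * b) (div_ne_zero hl0 hD0)
    (div_ne_zero hm0 hD0) ?_ ?_ ?_ ?_ ?_ ?_ ?_
  · field_simp
  · field_simp
  · field_simp
  · field_simp
  · linear_combination (1 / 2 - q₂ * (a ^ 2 / 2)) * hmsr + a ^ 2 / 2 * hsq
  · linear_combination -(q₂ * (a * b)) * hmsr + a * b * hsq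
  · linear_combination (1 / 2 - q₂ * (b ^ 2 / 2)) * hmsr + b ^ 2 / 2 * hsq

theorem IsPolyCurve.eval_smul_quad {f : ℂ → Quad} (hf : IsPolyCurve fun s => (f s : Poly))
    (p : ℂ[X]) : IsPolyCurve fun s => ((p.eval s • f s : Quad) : Poly) := by
  simpa only [Submodule.coe_smul, smul_eq_C_mul] using (IsPolyCurve.C_eval p).mul hf

theorem IsPolyCurve.linForm_coeff {U V : ℂ → Quad} (hU : IsPolyCurve fun s => (U s : Poly))
    (hV : IsPolyCurve fun s => (V s : Poly)) (p₀ p₁ p₂ : ℂ[X]) :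
    IsPolyCurve fun s => ((p₀.eval s • zSq + p₁.eval s • U s + p₂.eval s • V s : Quad) : Poly) :=
  ((IsPolyCurve.eval_smul_quad (f := fun _ => zSq) (.const _) p₀).add
    (hU.eval_smul_quad p₁)).add (hV.eval_smul_quad p₂)

theorem quadratic_ne_zero {a b c : ℂ} (ha : a ≠ 0) :
    (.C a * .X ^ 2 + .C b * .X + .C c : ℂ[X]) ≠ 0 := fun h => by
  have := Polynomial.leadingCoeff_quadratic (b := b) (c := c) ha
  rw [h, Polynomial.leadingCoeff_zero] at this
  exact ha this.symm

/-- The exceptional values of the coefficients are avoided along a line. -/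
theorem linForm_foldQuad_mem (p₁ p₂ q₁ q₂ a b c d e : ℂ) :
    linForm 1 p₁ p₂ 0 q₁ q₂ (foldQuad q₂ a b) (conic 0 a b c d e)
      ∈ zariskiClosure (X 3 ![2, 2]) := by
  let P₂ : ℂ[X] := .C p₂ + .X
  let Q₁ : ℂ[X] := .C q₁ - 2 * .X
  let Q₂ : ℂ[X] := .C q₂ + .X
  let U : ℂ → Quad := fun s => foldQuad (Q₂.eval s) a b
  have hU : IsPolyCurve fun s => (U s : Poly) := by
    simpa [U, foldQuad] using isPolyCurve_conic 0 0 0 (.C (1 / 2) - Q₂ * .C (a ^ 2 / 2))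
      (-(Q₂ * .C (a * b))) (.C (1 / 2) - Q₂ * .C (b ^ 2 / 2))
  let V : ℂ → Quad := fun _ => conic 0 a b c d e
  have hV : IsPolyCurve fun s => (V s : Poly) := .const (conic 0 a b c d e : Poly)
  have key := mem_zariskiClosure_of_infinite (S := zariskiClosure (X 3 ![2, 2]))
    (fun s => linForm ((1 : ℂ[X]).eval s) ((Polynomial.C p₁).eval s) (P₂.eval s)
      ((0 : ℂ[X]).eval s) (Q₁.eval s) (Q₂.eval s) (U s) (V s))
    (IsPolyCurve.diffForm_P (hU.linForm_coeff hV _ _ _) (hU.linForm_coeff hV _ _ _) hU hV)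
    (IsPolyCurve.diffForm_Q (hU.linForm_coeff hV _ _ _) (hU.linForm_coeff hV _ _ _) hU hV) ?_ 0
  · have key := zariskiClosure_subset_of_subset subset_rfl key
    simpa [U, V, P₂, Q₁, Q₂] using key
  -- the leading coefficients of the determinant and of the discriminant are `2` and `1`
  let D : ℂ[X] := .C p₁ * Q₂ - Q₁ * P₂
  let E : ℂ[X] := (P₂ - Q₁) ^ 2 - 4 * D
  have hQ₂ : Q₂ ≠ 0 := fun h => by
    have := congrArg (fun f => f.coeff 1) h
    simp [Q₂] at this
  have hD : D ≠ 0 := by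
    have e : D = .C 2 * .X ^ 2 + .C (p₁ + 2 * p₂ - q₁) * .X + .C (p₁ * q₂ - q₁ * p₂) := by
      simp only [D, P₂, Q₁, Q₂, map_add, map_sub, map_mul, map_ofNat]
      ring
    rw [e]
    exact quadratic_ne_zero (by norm_num)
  have hE : E ≠ 0 := by
    have e : E = .C 1 * .X ^ 2 + .C (6 * (p₂ - q₁) - 4 * (p₁ + 2 * p₂ - q₁)) * .X
        + .C ((p₂ - q₁) ^ 2 - 4 * (p₁ * q₂ - q₁ * p₂)) := by
      simp only [E, D, P₂, Q₁, Q₂, map_add, map_sub, map_mul, map_ofNat, map_pow, map_one]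
      ring
    rw [e]
    exact quadratic_ne_zero (by norm_num)
  have hfin := (Polynomial.rootSet_finite (Q₂ * D * E) ℂ).infinite_compl
  refine hfin.mono fun s hs => ?_
  have hs' : (Q₂ * D * E).eval s ≠ 0 := by
    intro h
    refine hs ?_
    rw [Polynomial.mem_rootSet]
    exact ⟨mul_ne_zero (mul_ne_zero hQ₂ hD) hE, by simpa using h⟩
  rw [Polynomial.eval_mul, Polynomial.eval_mul] at hs'
  have h₁ := left_ne_zero_of_mul (left_ne_zero_of_mul hs')
  have h₂ := right_ne_zero_of_mul (left_ne_zero_of_mul hs')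
  have h₃ := right_ne_zero_of_mul hs'
  simp only [Set.mem_ofPred_eq, Polynomial.eval_one, Polynomial.eval_zero, Polynomial.eval_C]
  exact linForm_foldQuad_mem_of_ne_zero h₁ (by simpa [D] using h₂) (by simpa [E, D] using h₃)

/-- Poincaré forms whose critical point lies on the fold `dU ∧ dV = 0`, with `U` adapted to the
form. -/
theorem linForm_mem_of_isPoincare_one {p₁ p₂ q₁ q₂ u₁ u₂ u₃ u₄ u₅ v₁ v₂ v₃ v₄ v₅ : ℂ}
    (h : (linForm 1 p₁ p₂ 0 q₁ q₂ (conic 0 u₁ u₂ u₃ u₄ u₅)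
      (conic 0 v₁ v₂ v₃ v₄ v₅)).IsPoincare) :
    linForm 1 p₁ p₂ 0 q₁ q₂ (conic 0 u₁ u₂ u₃ u₄ u₅) (conic 0 v₁ v₂ v₃ v₄ v₅)
      ∈ zariskiClosure (X 3 ![2, 2]) := by
  have h' := h
  simp only [linForm, zSq, smul_conic, conic_add, isPoincare_diffForm_iff] at h'
  obtain ⟨h₁, h₂, h₃, h₄, h₅, -⟩ := h'
  have e₁ : u₁ = 0 := by linear_combination h₁
  have e₂ : u₂ = 0 := by linear_combination h₂
  subst e₁ e₂
  have e₃ : u₃ = 1 / 2 - q₂ * (v₁ ^ 2 / 2) := by linear_combination h₃ / 2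
  have e₄ : u₄ = -(q₂ * (v₁ * v₂)) := by linear_combination h₅
  have e₅ : u₅ = 1 / 2 - q₂ * (v₂ ^ 2 / 2) := by linear_combination h₄ / 2
  rw [e₃, e₄, e₅]
  exact linForm_foldQuad_mem p₁ p₂ q₁ q₂ v₁ v₂ v₃ v₄ v₅

theorem linForm_mem_of_ne_zero {p₀ p₁ p₂ q₀ q₁ q₂ u₁ u₂ u₃ u₄ u₅ v₁ v₂ v₃ v₄ v₅ : ℂ}
    (hp : p₀ ≠ 0)
    (h : (linForm p₀ p₁ p₂ q₀ q₁ q₂ (conic 0 u₁ u₂ u₃ u₄ u₅)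
      (conic 0 v₁ v₂ v₃ v₄ v₅)).IsPoincare) :
    linForm p₀ p₁ p₂ q₀ q₁ q₂ (conic 0 u₁ u₂ u₃ u₄ u₅) (conic 0 v₁ v₂ v₃ v₄ v₅)
      ∈ zariskiClosure (X 3 ![2, 2]) := by
  rw [linForm_eq_of_ne_zero (inv_mul_cancel₀ hp), smul_conic, smul_conic, conic_add] at h ⊢
  simp only [mul_zero, add_zero] at h ⊢
  exact linForm_mem_of_isPoincare_one h

/-- Poincaré forms whose critical point is mapped to the singular point of the linear vector
field. The map is then a local change of coordinates, and the coefficients `p₁, p₂, q₁, q₂` form a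
nondegenerate symmetric matrix; its two isotropic combinations of `U` and `V` are conics that cross
at the critical point. -/
theorem linForm_mem_of_eq_zero {p₁ p₂ q₁ q₂ u₁ u₂ u₃ u₄ u₅ v₁ v₂ v₃ v₄ v₅ : ℂ}
    (h : (linForm 0 p₁ p₂ 0 q₁ q₂ (conic 0 u₁ u₂ u₃ u₄ u₅)
      (conic 0 v₁ v₂ v₃ v₄ v₅)).IsPoincare) :
    linForm 0 p₁ p₂ 0 q₁ q₂ (conic 0 u₁ u₂ u₃ u₄ u₅) (conic 0 v₁ v₂ v₃ v₄ v₅)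
      ∈ zariskiClosure (X 3 ![2, 2]) := by
  have h' := h
  simp only [linForm, zSq, smul_conic, conic_add, isPoincare_diffForm_iff] at h'
  obtain ⟨-, -, h₃, h₄, h₅, h₆⟩ := h'
  obtain ⟨l₁, hl₁⟩ : ∃ t, t = p₁ * u₁ + p₂ * v₁ := ⟨_, rfl⟩
  obtain ⟨l₂, hl₂⟩ : ∃ t, t = p₁ * u₂ + p₂ * v₂ := ⟨_, rfl⟩
  obtain ⟨m₁, hm₁⟩ : ∃ t, t = q₁ * u₁ + q₂ * v₁ := ⟨_, rfl⟩
  obtain ⟨m₂, hm₂⟩ : ∃ t, t = q₁ * u₂ + q₂ * v₂ := ⟨_, rfl⟩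
  have f₁ : l₁ * u₁ + m₁ * v₁ = 1 := by rw [hl₁, hm₁]; linear_combination h₃
  have f₂ : l₂ * u₂ + m₂ * v₂ = 1 := by rw [hl₂, hm₂]; linear_combination h₄
  have f₃ : l₂ * u₁ + m₂ * v₁ = 0 := by rw [hl₂, hm₂]; linear_combination h₅
  have f₄ : l₁ * u₂ + m₁ * v₂ = 0 := by rw [hl₁, hm₁]; linear_combination h₆
  have hinv : (!![u₁, u₂; v₁, v₂] : Matrix (Fin 2) (Fin 2) ℂ) * !![l₁, m₁; l₂, m₂] = 1 := by
    rw [mul_eq_one_comm, Matrix.mul_fin_two, f₁, f₂, f₃, f₄, Matrix.one_fin_two]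
  rw [Matrix.mul_fin_two, Matrix.one_fin_two] at hinv
  have g₁ : u₁ * l₁ + u₂ * l₂ = 1 := congrFun (congrFun hinv 0) 0
  have g₂ : u₁ * m₁ + u₂ * m₂ = 0 := congrFun (congrFun hinv 0) 1
  have g₃ : v₁ * l₁ + v₂ * l₂ = 0 := congrFun (congrFun hinv 1) 0
  have g₄ : v₁ * m₁ + v₂ * m₂ = 1 := congrFun (congrFun hinv 1) 1
  have k₁ : p₁ = l₁ * l₁ + l₂ * l₂ := by
    linear_combination -l₁ * hl₁ - l₂ * hl₂ - p₁ * g₁ - p₂ * g₃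
  have k₂ : p₂ = l₁ * m₁ + l₂ * m₂ := by
    linear_combination -m₁ * hl₁ - m₂ * hl₂ - p₁ * g₂ - p₂ * g₄
  have k₃ : q₁ = l₁ * m₁ + l₂ * m₂ := by
    linear_combination -l₁ * hm₁ - l₂ * hm₂ - q₁ * g₁ - q₂ * g₃
  have k₄ : q₂ = m₁ * m₁ + m₂ * m₂ := by
    linear_combination -m₁ * hm₁ - m₂ * hm₂ - q₁ * g₂ - q₂ * g₄
  have hI : (C Complex.I : Poly) ^ 2 = -1 := by rw [← C_pow, Complex.I_sq, C_neg, C_1]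
  have half : (C (1 / 2) : Poly) * 2 = 1 := by
    rw [show (2 : Poly) = C 2 from (map_ofNat C 2).symm, ← C_mul]
    norm_num
  have split : ∀ U V : Quad, linForm 0 p₁ p₂ 0 q₁ q₂ U V
      = diffForm ((1 / 2 : ℂ) • ((l₁ - Complex.I * l₂) • U + (m₁ - Complex.I * m₂) • V))
        ((1 / 2 : ℂ) • ((l₁ + Complex.I * l₂) • U + (m₁ + Complex.I * m₂) • V))
        ((l₁ + Complex.I * l₂) • U + (m₁ + Complex.I * m₂) • V)
        ((l₁ - Complex.I * l₂) • U + (m₁ - Complex.I * m₂) • V) := by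
    intro U V
    rw [k₁, k₂, k₃, k₄]
    refine Form.ext_PQ ?_ ?_
    · simp only [linForm, diffForm_P, Submodule.coe_add, Submodule.coe_smul, Derivation.map_add,
        smul_eq_C_mul, pderiv_C_mul]
      simp only [C_mul, C_sub, C_add, C_0]
      linear_combination (-(((C l₁ * C l₁ + C l₂ * C l₂) * U + (C l₁ * C m₁ + C l₂ * C m₂) * V)
        * pderiv 0 (U : Poly) + ((C l₁ * C m₁ + C l₂ * C m₂) * U
        + (C m₁ * C m₁ + C m₂ * C m₂) * V) * pderiv 0 (V : Poly))) * half
        + C (1 / 2) * 2 * (C l₂ * U + C m₂ * V) * (C l₂ * pderiv 0 (U : Poly)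
        + C m₂ * pderiv 0 (V : Poly)) * hI
    · simp only [linForm, diffForm_Q, Submodule.coe_add, Submodule.coe_smul, Derivation.map_add,
        smul_eq_C_mul, pderiv_C_mul]
      simp only [C_mul, C_sub, C_add, C_0]
      linear_combination (-(((C l₁ * C l₁ + C l₂ * C l₂) * U + (C l₁ * C m₁ + C l₂ * C m₂) * V)
        * pderiv 1 (U : Poly) + ((C l₁ * C m₁ + C l₂ * C m₂) * U
        + (C m₁ * C m₁ + C m₂ * C m₂) * V) * pderiv 1 (V : Poly))) * half
        + C (1 / 2) * 2 * (C l₂ * U + C m₂ * V) * (C l₂ * pderiv 1 (U : Poly)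
        + C m₂ * pderiv 1 (V : Poly)) * hI
  rw [split, smul_conic_add_smul_conic, smul_conic_add_smul_conic]
  refine diffForm_mem_of_crossing rfl ?_ ?_ rfl ?_ ?_
  · linear_combination f₁ + Complex.I * f₃
  · linear_combination f₄ + Complex.I * f₂
  · linear_combination f₁ - Complex.I * f₃
  · linear_combination f₄ - Complex.I * f₂

/-- Every Poincaré form that is the pullback of a linear vector field under a quadratic map lies
in the closure of the forms with two integral conics in general position. -/
theorem linForm_mem_zariskiClosure {p₀ p₁ p₂ q₀ q₁ q₂ u₀ u₁ u₂ u₃ u₄ u₅ v₀ v₁ v₂ v₃ v₄ v₅ : ℂ}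
    (h : (linForm p₀ p₁ p₂ q₀ q₁ q₂ (conic u₀ u₁ u₂ u₃ u₄ u₅)
      (conic v₀ v₁ v₂ v₃ v₄ v₅)).IsPoincare) :
    linForm p₀ p₁ p₂ q₀ q₁ q₂ (conic u₀ u₁ u₂ u₃ u₄ u₅) (conic v₀ v₁ v₂ v₃ v₄ v₅)
      ∈ zariskiClosure (X 3 ![2, 2]) := by
  have shift : ∀ w₀ w₁ w₂ w₃ w₄ w₅ : ℂ,
      conic w₀ w₁ w₂ w₃ w₄ w₅ = w₀ • zSq + conic 0 w₁ w₂ w₃ w₄ w₅ := by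
    intro w₀ w₁ w₂ w₃ w₄ w₅
    simp [zSq, smul_conic, conic_add]
  rw [shift u₀, shift v₀, linForm_add_zSq] at h ⊢
  by_cases hp : p₀ + p₁ * u₀ + p₂ * v₀ = 0
  · by_cases hq : q₀ + q₁ * u₀ + q₂ * v₀ = 0
    · rw [hp, hq] at h ⊢
      exact linForm_mem_of_eq_zero h
    · rw [linForm_swap] at h ⊢
      exact linForm_mem_of_ne_zero hq h
  · exact linForm_mem_of_ne_zero hp h

/-! ### The generic member of the family -/

namespace CR7

variable (c k l m n p : ℂ)

theorem curl_form :
    (form c k l m n p).curl = -(C (2 * l - m) * x * (2 * x + C c * z)) := by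
  simp only [Form.curl, Form.P, Form.Q, form, polyP, polyQ, T, map_neg, map_add, map_sub, map_mul,
    pderiv_mul, pderiv_pow, pderiv_X, pderiv_C, Pi.single_apply, map_ofNat, Fin.isValue]
  simp
  ring

/-- The pencil spanned by the conics `F`, `G` recovers the form: it is proportional to
`l G dF - (l - m) F dG`. -/
theorem pencil_dx :
    C l * conicG c k l * pderiv 0 (conicF c k l m n p)
      - C (l - m) * conicF c k l m n p * pderiv 0 (conicG c k l)
      = -(C (l * m * (l - m)) * (form c k l m n p).P) := by
  simp only [Form.P, form, polyP, conicF, conicG, T, map_neg, map_add, map_sub, map_mul, map_pow,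
    pderiv_mul, pderiv_pow, pderiv_X, pderiv_C, Pi.single_apply, Fin.isValue]
  simp
  ring

theorem pencil_dy :
    C l * conicG c k l * pderiv 1 (conicF c k l m n p)
      - C (l - m) * conicF c k l m n p * pderiv 1 (conicG c k l)
      = -(C (l * m * (l - m)) * (form c k l m n p).Q) := by
  simp only [Form.Q, form, polyQ, conicF, conicG, T, map_neg, map_add, map_sub, map_mul, map_pow,
    pderiv_mul, pderiv_pow, pderiv_X, pderiv_C, Pi.single_apply, Fin.isValue]
  simp
  ring

theorem form_conicF_identity :
    (form c k l m n p).P * pderiv 1 (conicF c k l m n p)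
      - (form c k l m n p).Q * pderiv 0 (conicF c k l m n p)
      = conicF c k l m n p * (C (l - m) * x * (2 * x + C c * z)) := by
  simp only [Form.P, Form.Q, form, polyP, polyQ, conicF, T, map_neg, map_add, map_sub, map_mul,
    map_pow, pderiv_mul, pderiv_pow, pderiv_X, pderiv_C, Pi.single_apply, Fin.isValue]
  simp
  ring

theorem form_conicG_identity :
    (form c k l m n p).P * pderiv 1 (conicG c k l)
      - (form c k l m n p).Q * pderiv 0 (conicG c k l)
      = conicG c k l * (C l * x * (2 * x + C c * z)) := by
  simp only [Form.P, Form.Q, form, polyP, polyQ, conicG, T, map_add, map_sub,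
    pderiv_mul, pderiv_pow, pderiv_X, pderiv_C, Pi.single_apply, Fin.isValue]
  simp
  ring

theorem jacobian_conics :
    pderiv 0 (conicF c k l m n p) * pderiv 1 (conicG c k l)
      - pderiv 1 (conicF c k l m n p) * pderiv 0 (conicG c k l)
      = -(C (l * m * (l - m)) * (x * (2 * x + C c * z))) := by
  simp only [conicF, conicG, T, map_neg, map_add, map_sub, map_mul, map_pow,
    pderiv_mul, pderiv_pow, pderiv_X, pderiv_C, Pi.single_apply, Fin.isValue]
  simp
  ring

theorem isHomogeneous_conicF : (conicF c k l m n p).IsHomogeneous 2 := by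
  have hx : (x).IsHomogeneous 1 := isHomogeneous_X _ _
  have hy : (y).IsHomogeneous 1 := isHomogeneous_X _ _
  have hz : (z).IsHomogeneous 1 := isHomogeneous_X _ _
  exact ((((hx.pow 2).C_mul _).add ((hx.C_mul _).mul hy)).add ((hx.C_mul _).mul hz)).add
    ((hz.pow 2).C_mul _)

theorem isHomogeneous_conicG : (conicG c k l).IsHomogeneous 2 := by
  have hx : (x).IsHomogeneous 1 := isHomogeneous_X _ _
  have hz : (z).IsHomogeneous 1 := isHomogeneous_X _ _
  exact ((hz.pow 2).C_mul _).add (((isHomogeneous_T c).C_mul _).mul hx)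

variable {c k l m n p}

theorem linearIndependent_conics (hl : l ≠ 0) (hm : m ≠ 0) (hlm : l - m ≠ 0) :
    LinearIndependent ℂ ![conicF c k l m n p, conicG c k l] := by
  rw [LinearIndependent.pair_iff]
  intro s t h
  have h₁ := congrArg (eval ![1, 0, 0]) h
  have h₂ := congrArg (eval ![1, 1, 0]) h
  simp [conicF, conicG, T, smul_eval] at h₁ h₂
  have hs : s = 0 := by
    have : (l - m) * m * s = 0 := by linear_combination h₂ - 2 * h₁
    simpa [hm, hlm] using this
  subst hs
  simpa [hl] using h₁

/-- A `3 × 2` matrix of rank less than `2` has vanishing `2 × 2` minors. -/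
theorem minor_eq_zero_of_rank_lt_two {M : Matrix (Fin 3) (Fin 2) ℂ} (hM : M.rank < 2)
    (i j : Fin 3) : M i 0 * M j 1 - M i 1 * M j 0 = 0 := by
  by_contra h
  have hdet : (M.submatrix ![i, j] id).det ≠ 0 := by
    rw [Matrix.det_fin_two]
    exact h
  have hrank := Matrix.rank_of_isUnit _ ((Matrix.isUnit_iff_isUnit_det _).2 hdet.isUnit)
  have hle := M.rank_submatrix_le ![i, j] id
  rw [hrank, Fintype.card_fin] at hle
  omega

/-- The Jacobian minor of the matrix cuts out the lines `x = 0` and `2 x + c z = 0`. The other two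
minors are multiples of `P` and `Q`, which restrict the locus to two points of the first line and
one point of the second. -/
theorem finite_rankDropLocus (hl : l ≠ 0) (hm : m ≠ 0) (hlm : l - m ≠ 0)
    (hnk : n + k ≠ 0) (hmp : m + p ≠ 0) {a b : ℂ} (ha : a * (2 * l - m) = l - m)
    (hb : b * (2 * l - m) = l) :
    (rankDropLocus (syzygyMatrix (conicF c k l m n p) (conicG c k l) a b)).Finite := by
  -- the point of the line `2 x + c z = 0` in the chart `z = 1`, where `Q / x = 0` gives `y`
  set h : ℂ := (n + k - (l - m) * c ^ 2 / 4) * 2 / ((m + p) * c) - c / 2 with hh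
  have ne₁ : (![0, 1, 0] : Fin 3 → ℂ) ≠ 0 := fun h0 => by simpa using congrFun h0 1
  have ne₂ : (![0, -(n * c) / (n + k), 1] : Fin 3 → ℂ) ≠ 0 := fun h0 => by
    simpa using congrFun h0 2
  have ne₃ : (![-c / 2, h, 1] : Fin 3 → ℂ) ≠ 0 := fun h0 => by simpa using congrFun h0 2
  refine Set.Finite.subset (s := {Projectivization.mk ℂ _ ne₁, Projectivization.mk ℂ _ ne₂,
    Projectivization.mk ℂ _ ne₃}) (by simp) fun q hq => ?_
  suffices key : ∀ (w : Fin 3 → ℂ) (hw : w ≠ 0),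
      ((syzygyMatrix (conicF c k l m n p) (conicG c k l) a b).map (eval w)).rank < 2 →
      Projectivization.mk ℂ w hw ∈ ({Projectivization.mk ℂ _ ne₁, Projectivization.mk ℂ _ ne₂,
        Projectivization.mk ℂ _ ne₃} : Set (Projectivization ℂ (Fin 3 → ℂ))) by
    rw [← q.mk_rep]
    exact key _ q.rep_nonzero hq
  intro w hw hq
  have minor := minor_eq_zero_of_rank_lt_two hq
  have hκ : l * m * (l - m) ≠ 0 := mul_ne_zero (mul_ne_zero hl hm) hlm
  have hJ : w 0 * (2 * w 0 + c * w 2) = 0 := by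
    have e := congrArg (eval w) (jacobian_conics c k l m n p)
    have e' : eval w (pderiv 0 (conicF c k l m n p)) * eval w (pderiv 1 (conicG c k l))
      - eval w (pderiv 0 (conicG c k l)) * eval w (pderiv 1 (conicF c k l m n p)) = 0 := minor 0 1
    simp only [map_sub, map_mul, map_neg, map_add, map_ofNat, eval_C, eval_X] at e
    have : l * m * (l - m) * (w 0 * (2 * w 0 + c * w 2)) = 0 := by linear_combination e - e'
    exact (mul_eq_zero.1 this).resolve_left hκ
  have hP : eval w (form c k l m n p).P = 0 := by
    have e := congrArg (eval w) (pencil_dx c k l m n p)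
    have e' : eval w (pderiv 0 (conicF c k l m n p)) * eval w (C b * conicG c k l)
      - eval w (pderiv 0 (conicG c k l)) * eval w (C a * conicF c k l m n p) = 0 := minor 0 2
    simp only [map_sub, map_mul, map_neg, eval_C] at e e'
    have : l * m * (l - m) * eval w (form c k l m n p).P = 0 := by
      linear_combination e - (2 * l - m) * e'
        + eval w (conicG c k l) * eval w (pderiv 0 (conicF c k l m n p)) * hb
        - eval w (conicF c k l m n p) * eval w (pderiv 0 (conicG c k l)) * ha
    exact (mul_eq_zero.1 this).resolve_left hκ
  have hQ : eval w (form c k l m n p).Q = 0 := by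
    have e := congrArg (eval w) (pencil_dy c k l m n p)
    have e' : eval w (pderiv 1 (conicF c k l m n p)) * eval w (C b * conicG c k l)
      - eval w (pderiv 1 (conicG c k l)) * eval w (C a * conicF c k l m n p) = 0 := minor 1 2
    simp only [map_sub, map_mul, map_neg, eval_C] at e e'
    have : l * m * (l - m) * eval w (form c k l m n p).Q = 0 := by
      linear_combination e - (2 * l - m) * e'
        + eval w (conicG c k l) * eval w (pderiv 1 (conicF c k l m n p)) * hb
        - eval w (conicF c k l m n p) * eval w (pderiv 1 (conicG c k l)) * ha
    exact (mul_eq_zero.1 this).resolve_left hκ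
  clear minor
  simp [Form.P, Form.Q, form, polyP, polyQ, T] at hP hQ
  simp only [Set.mem_insert_iff, Set.mem_singleton_iff, Projectivization.mk_eq_mk_iff']
  by_cases hx : w 0 = 0
  · rw [hx] at hP
    have hP' : w 2 ^ 2 * ((n + k) * w 1 + n * c * w 2) = 0 := by linear_combination -hP
    rcases mul_eq_zero.1 hP' with hz | hy
    · have hz := pow_eq_zero_iff two_ne_zero |>.1 hz
      refine Or.inl ⟨w 1, ?_⟩
      ext i
      fin_cases i <;> simp [hx, hz]
    · refine Or.inr (Or.inl ⟨w 2, ?_⟩)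
      ext i
      fin_cases i <;> simp [hx]
      field_simp
      linear_combination -hy
  · have hxz : 2 * w 0 + c * w 2 = 0 := (mul_eq_zero.1 hJ).resolve_left hx
    have hx' : w 0 = w 2 * (-c / 2) := by linear_combination hxz / 2
    have hz : w 2 ≠ 0 := fun h0 => hx (by rw [hx', h0, zero_mul])
    have hc : c ≠ 0 := fun h0 => hx (by rw [hx', h0]; simp)
    refine Or.inr (Or.inr ⟨w 2, ?_⟩)
    have hQ' := hQ.resolve_left hx
    rw [hx'] at hQ'
    ext i
    fin_cases i <;> simp [hx', hh]
    field_simp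
    have : w 2 * (w 2 * (4 * (n + k) - (l - m) * c ^ 2 - c ^ 2 * (m + p))
        - 2 * c * (m + p) * w 1) = 0 := by linear_combination -4 * hQ'
    linear_combination 4 * (mul_eq_zero.1 this).resolve_left hz

/-- The properties of the generic member of the family, under explicit genericity conditions. -/
theorem generic_form (hl : l ≠ 0) (hm : m ≠ 0) (hlm : l - m ≠ 0) (h2 : 2 * l - m ≠ 0)
    (hnk : n + k ≠ 0) (hmp : m + p ≠ 0) {ω : Form 3} {F G : Poly} {a b : ℂ}
    (hω : ω = form c k l m n p) (hF : F = conicF c k l m n p) (hG : G = conicG c k l)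
    (ha : a = (l - m) / (2 * l - m)) (hb : b = l / (2 * l - m)) :
    F.IsHomogeneous 2 ∧ G.IsHomogeneous 2 ∧ LinearIndependent ℂ ![F, G] ∧
      ω.IsIntegralCurve F ∧ ω.IsIntegralCurve G ∧ 2 * l - m ≠ 0 ∧ a ≠ 0 ∧ b ≠ 0 ∧
      Matrix.vecMul ![-ω.Q, ω.P, ω.curl] (syzygyMatrix F G a b) = 0 ∧
      (rankDropLocus (syzygyMatrix F G a b)).Finite ∧ ω.IsDarbouxIntegrable := by
  subst hω hF hG
  have hind := linearIndependent_conics (c := c) (k := k) (n := n) (p := p) hl hm hlm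
  have hK : (form c k l m n p).curl.IsHomogeneous 2 := by
    have hz : (C c * z).IsHomogeneous 1 := isHomogeneous_C_mul_X _ _
    have hx : (2 * x : Poly).IsHomogeneous 1 := isHomogeneous_C_mul_X 2 0
    rw [curl_form]
    exact (((isHomogeneous_C_mul_X _ _).mul (hx.add hz))).neg
  have ha' : a * (2 * l - m) = l - m := by rw [ha, div_mul_cancel₀ _ h2]
  have hb' : b * (2 * l - m) = l := by rw [hb, div_mul_cancel₀ _ h2]
  have hFω : (form c k l m n p).P * pderiv 1 (conicF c k l m n p)
      - (form c k l m n p).Q * pderiv 0 (conicF c k l m n p)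
      = -(conicF c k l m n p * (C a * (form c k l m n p).curl)) := by
    rw [form_conicF_identity, curl_form, ← ha', C_mul]
    ring
  have hGω : (form c k l m n p).P * pderiv 1 (conicG c k l)
      - (form c k l m n p).Q * pderiv 0 (conicG c k l)
      = -(conicG c k l * (C b * (form c k l m n p).curl)) := by
    have e := form_conicG_identity c k l m n p
    rw [e, curl_form]
    nth_rw 2 [← hb']
    rw [C_mul]
    ring
  have hFi : (form c k l m n p).IsIntegralCurveWithCofactor (conicF c k l m n p)
      (C a * (form c k l m n p).curl) :=
    ⟨hind.ne_zero 0, ⟨2, two_pos, isHomogeneous_conicF ..⟩, hK.C_mul a, hFω⟩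
  have hGi : (form c k l m n p).IsIntegralCurveWithCofactor (conicG c k l)
      (C b * (form c k l m n p).curl) :=
    ⟨hind.ne_zero 1, ⟨2, two_pos, isHomogeneous_conicG ..⟩, hK.C_mul b, hGω⟩
  refine ⟨isHomogeneous_conicF .., isHomogeneous_conicG .., hind, ⟨_, hFi⟩, ⟨_, hGi⟩, h2,
    ha ▸ div_ne_zero hlm h2, hb ▸ div_ne_zero hl h2, ?_,
    finite_rankDropLocus hl hm hlm hnk hmp ha' hb', ?_⟩
  · ext j : 1
    fin_cases j
    · simp [Matrix.vecMul, dotProduct, Fin.sum_univ_three, syzygyMatrix]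
      linear_combination hFω
    · simp [Matrix.vecMul, dotProduct, Fin.sum_univ_three, syzygyMatrix]
      linear_combination hGω
  · refine ⟨2, ![conicF c k l m n p, conicG c k l],
      ![C a * (form c k l m n p).curl, C b * (form c k l m n p).curl], 1, ?_, ?_⟩
    · intro i
      fin_cases i
      · exact hFi
      · exact hGi
    · have hab : a + b = 1 := by
        rw [ha, hb, ← add_div, div_eq_one_iff_eq h2]
        ring
      simp [← add_mul, ← C_add, hab]

/-! ### The family as a family of pullbacks of linear vector fields -/

/-- In terms of `R = x (x + c z)` and `S = x T` the form is
`(k z² + l S) dR + (-(n + k) z² - (l - m) R - (m + p) S) dS`. An affine change of coordinates only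
changes the two quadratic polynomials. -/
theorem form_pullback_eq_linForm (A : Matrix (Fin 2) (Fin 2) ℂ) (t : Fin 2 → ℂ)
    (c k l m n p : ℂ) :
    (form c k l m n p).pullback A t = linForm k 0 l (-(n + k)) (-(l - m)) (-(m + p))
      (conic (t 0 * (t 0 + c)) (A 0 0 * (2 * t 0 + c)) (A 0 1 * (2 * t 0 + c)) (A 0 0 ^ 2)
        (2 * A 0 0 * A 0 1) (A 0 1 ^ 2))
      (conic (t 0 * (t 0 + t 1 + c)) (A 0 0 * (t 0 + t 1 + c) + t 0 * (A 0 0 + A 1 0))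
        (A 0 1 * (t 0 + t 1 + c) + t 0 * (A 0 1 + A 1 1)) (A 0 0 * (A 0 0 + A 1 0))
        (A 0 0 * (A 0 1 + A 1 1) + A 0 1 * (A 0 0 + A 1 0)) (A 0 1 * (A 0 1 + A 1 1))) := by
  obtain ⟨ξ, hξ⟩ : ∃ ξ : Poly, ξ = C (A 0 0) * x + C (A 0 1) * y + C (t 0) * z := ⟨_, rfl⟩
  obtain ⟨η, hη⟩ : ∃ η : Poly, η = C (A 1 0) * x + C (A 1 1) * y + C (t 1) * z := ⟨_, rfl⟩
  have hx : affineSubst A t (MvPolynomial.X 0) = ξ := by simp [affineSubst, hξ]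
  have hy : affineSubst A t (MvPolynomial.X 1) = η := by simp [affineSubst, hη]
  have hz : affineSubst A t (MvPolynomial.X 2) = MvPolynomial.X 2 := by simp [affineSubst]
  have hC : ∀ a, affineSubst A t (C a) = C a := fun a => (affineSubst A t).commutes a
  have dx : pderiv 0 ξ = C (A 0 0) := by rw [hξ]; simp [pderiv_X]
  have dy : pderiv 1 ξ = C (A 0 1) := by rw [hξ]; simp [pderiv_X]
  have dx' : pderiv 0 η = C (A 1 0) := by rw [hη]; simp [pderiv_X]
  have dy' : pderiv 1 η = C (A 1 1) := by rw [hη]; simp [pderiv_X]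
  have dz : pderiv 0 (MvPolynomial.X 2 : Poly) = 0 := by simp [pderiv_X]
  have dz' : pderiv 1 (MvPolynomial.X 2 : Poly) = 0 := by simp [pderiv_X]
  have hS : (zSq : Poly) = MvPolynomial.X 2 ^ 2 := by simp [zSq, conic]
  obtain ⟨U, hUq⟩ : ∃ U, U = conic (t 0 * (t 0 + c)) (A 0 0 * (2 * t 0 + c)) (A 0 1 * (2 * t 0 + c))
    (A 0 0 ^ 2) (2 * A 0 0 * A 0 1) (A 0 1 ^ 2) := ⟨_, rfl⟩
  obtain ⟨V, hVq⟩ : ∃ V, V = conic (t 0 * (t 0 + t 1 + c))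
    (A 0 0 * (t 0 + t 1 + c) + t 0 * (A 0 0 + A 1 0))
    (A 0 1 * (t 0 + t 1 + c) + t 0 * (A 0 1 + A 1 1)) (A 0 0 * (A 0 0 + A 1 0))
    (A 0 0 * (A 0 1 + A 1 1) + A 0 1 * (A 0 0 + A 1 0)) (A 0 1 * (A 0 1 + A 1 1)) := ⟨_, rfl⟩
  have hU : (U : Poly) = ξ * (ξ + C c * MvPolynomial.X 2) := by
    rw [hUq, hξ]
    simp only [conic, C_mul, C_add, C_pow, x, y, z, map_ofNat]
    ring
  have hV : (V : Poly) = ξ * (ξ + η + C c * MvPolynomial.X 2) := by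
    rw [hVq, hξ, hη]
    simp only [conic, C_mul, C_add, x, y, z]
    ring
  rw [← hUq, ← hVq]
  clear hUq hVq hξ hη
  refine Form.ext_PQ ?_ ?_
  · have e : ((form c k l m n p).pullback A t).P = C (A 0 0) * affineSubst A t (polyP c k l m n p)
      + C (A 1 0) * affineSubst A t (polyQ c k l m n p) := rfl
    rw [e]
    simp only [linForm, diffForm_P, Submodule.coe_add, Submodule.coe_smul, smul_eq_C_mul, hS, hU,
      hV, pderiv_mul, pderiv_C, dx, dx', dz, polyP, polyQ, T, x, y, z,
      map_neg, map_add, map_sub, map_mul, map_pow, hx, hy, hz, hC, C_0]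
    ring
  · have e : ((form c k l m n p).pullback A t).Q = C (A 0 1) * affineSubst A t (polyP c k l m n p)
      + C (A 1 1) * affineSubst A t (polyQ c k l m n p) := rfl
    rw [e]
    simp only [linForm, diffForm_Q, Submodule.coe_add, Submodule.coe_smul, smul_eq_C_mul, hS, hU,
      hV, pderiv_mul, pderiv_C, dy, dy', dz', polyP, polyQ, T, x, y, z,
      map_neg, map_add, map_sub, map_mul, map_pow, hx, hy, hz, hC, C_0]
    ring

theorem poincareFamily_subset_zariskiClosure :
    poincareFamily ⊆ zariskiClosure (CenterProblem.X 3 ![2, 2]) := by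
  rintro ω ⟨⟨A, t, c, k, l, m, n, p, -, rfl⟩, h⟩
  rw [form_pullback_eq_linForm] at h ⊢
  exact linForm_mem_zariskiClosure h

end CR7

end CenterProblem

theorem mainTheorem9 :
    (∃ D : MvPolynomial (Fin 6) ℂ, D ≠ 0 ∧
      ∀ c k l m n p : ℂ, MvPolynomial.eval ![c, k, l, m, n, p] D ≠ 0 →
        ∀ (ω : CenterProblem.Form 3) (F G : CenterProblem.Poly) (a b : ℂ),
          ω = CenterProblem.CR7.form c k l m n p →
          F = CenterProblem.CR7.conicF c k l m n p →
          G = CenterProblem.CR7.conicG c k l →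
          a = (l - m) / (2 * l - m) →
          b = l / (2 * l - m) →
          F.IsHomogeneous 2 ∧ G.IsHomogeneous 2 ∧ LinearIndependent ℂ ![F, G] ∧
          ω.IsIntegralCurve F ∧ ω.IsIntegralCurve G ∧
          2 * l - m ≠ 0 ∧ a ≠ 0 ∧ b ≠ 0 ∧
          Matrix.vecMul ![-ω.Q, ω.P, ω.curl] (CenterProblem.syzygyMatrix F G a b) = 0 ∧
          (CenterProblem.rankDropLocus (CenterProblem.syzygyMatrix F G a b)).Finite ∧
          ω.IsDarbouxIntegrable) ∧
    CenterProblem.CR7.poincareFamily ⊆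
      CenterProblem.zariskiClosure (CenterProblem.X 3 ![2, 2]) := by
  refine ⟨⟨MvPolynomial.X 2 * MvPolynomial.X 3 * (MvPolynomial.X 2 - MvPolynomial.X 3)
    * (2 * MvPolynomial.X 2 - MvPolynomial.X 3) * (MvPolynomial.X 4 + MvPolynomial.X 1)
    * (MvPolynomial.X 3 + MvPolynomial.X 5), ?_, ?_⟩,
    CenterProblem.CR7.poincareFamily_subset_zariskiClosure⟩
  · intro h
    have := congrArg (MvPolynomial.eval ![0, 1, 3, 1, 0, 0]) h
    simp at this
    norm_num at this
  · intro c k l m n p hD ω F G a b hω hF hG ha hb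
    simp only [map_mul, map_sub, map_add, MvPolynomial.eval_X, map_ofNat, mul_ne_zero_iff] at hD
    obtain ⟨⟨⟨⟨⟨hl, hm⟩, hlm⟩, h2⟩, hnk⟩, hmp⟩ := hD
    exact CenterProblem.CR7.generic_form hl hm hlm h2 hnk hmp hω hF hG ha hb
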